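/- **Setting.** Let $d\ge 2$ and write $\boldsymbol x=(\tilde{\boldsymbol x},x_d)\in[0,1]^{d-1}\times[0,1]$. Let $g^*:[0,1]^{d-1}\to[0,1]$ be the true decision boundary (it may be Hölder smooth, but no smoothness is needed here); the true label of $\boldsymbol x$ is $\mathbb 1[x_d>g^*(\tilde{\boldsymbol x})]$. A query at $\boldsymbol x$ is answered by a labeler with some $Y\in\{0,1,\perp\}$ drawn from $P(\cdot\mid\boldsymbol x)$, independently of the past. Write $\ln$ for the natural logarithm and $[\ln\ln]_+(x)=\ln\ln\max\{x,e^e\}$. **Condition 1.** (abstention) If $|x_d-g^*(\tilde{\boldsymbol x})|\ge|x_d'-g^*(\tilde{\boldsymbol x})|$ then $P(\perp\mid(\tilde{\boldsymbol x},x_d))\le P(\perp\mid(\tilde{\boldsymbol x},x_d'))$; (noise) $P(Y\ne\mathbb 1[x_d>g^*(\tilde{\boldsymbol x})]\mid\boldsymbol x,Y\ne\perp)\le\frac12$. **Condition 3** (with $f$ and $c\in(0,1)$). $f:[0,1]\to[0,1]$ is nondecreasing, $f(a)>0$ and $f(b)/f(a)\le 1-c$ for all $0<a\le1$, $0\le b\le\frac23a$,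 and $P(\perp\mid\boldsymbol x)=1-f(|x_d-g^*(\tilde{\boldsymbol x})|)$. **Tests.** For a list $X=(X_1,\dots,X_n)$ let $V_n=\frac n{n-1}\bigl(\sum X_i^2-\frac1n(\sum X_i)^2\bigr)$ (and $V_1=0$), $p(n,\delta)=D_0\bigl(1+\ln\frac1\delta+\sqrt{4n([\ln\ln]_+(4n)+\ln\frac1\delta)}\bigr)$ and $q(V,\delta)=D_1\bigl(1+\ln\frac1\delta+\sqrt{(V+\ln\frac1\delta+1)([\ln\ln]_+(V+\ln\frac1\delta+1)+\ln\frac1\delta)}\bigr)$. CheckSignificant$(X,\delta)$ holds iff $\sum X_i\ge p(n,\delta)$; CheckSignificant-Var$(X,\delta)$ holds iff $n\ge\ln\frac1\delta$ and $\sum X_i\ge q(V_n,\delta)$. Here $D_0,D_1$ are admissible absolute constants: for every i.i.d. sequence $X_i\in[-2,2]$ of mean zero and every $\delta\in(0,1)$, with probability at least $1-\delta$, $|\sum_{i\le n}X_i|\le p(n,\delta)$ for all $n>0$ simultaneously; respectively, with probability at least $1-\delta$, $|\sum_{i\le n}X_i|\le q(V_n,\delta)$ for all $n\ge\ln\frac1\delta$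 simultaneously. **Algorithm 1** (one-dimensional; parameters $\epsilon,\delta$). Start with $[L,R]=[0,1]$ and make $k_{\max}=\max\{0,\lceil\log_{4/3}\frac1{2\epsilon}\rceil\}$ passes, with $\eta=\delta/(4k_{\max})$. In a pass put $U=\frac{3L+R}4$, $M=\frac{L+R}2$, $V=\frac{L+3R}4$. For $n=1,2,\dots$ query once at each of $U,M,V$. Let $A^{(w)}_i\in\{0,1\}$ record whether the $i$-th response at $w\in\{u,m,v\}$ was not $\perp$, and let $B^{(w)}$ list the non-abstaining labels, with $0,1$ recorded as $-1,1$. The first of the following tests that holds ends the pass: CheckSignificant-Var on $(A^{(u)}_i-A^{(m)}_i)_{i\le n}$ (new interval $[U,R]$); CheckSignificant-Var on $(A^{(v)}_i-A^{(m)}_i)_{i\le n}$ (new interval $[L,V]$); CheckSignificant on $-B^{(u)}$ ($[U,R]$); CheckSignificant on $B^{(v)}$ ($[L,V]$); all at level $\eta$. If none holds, go on with $n+1$. The output is the midpoint of the last interval. **Algorithm 2** (parameters $\epsilon,\delta$, an integer $\gamma\ge1$, and a positive multiple $M$ of $\gamma$ of order $\epsilon^{-1/\gamma}$). For each $l\in\{0,\frac1M,\dots,\frac{M-1}M\}^{d-1}$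 run Algorithm 1 with parameters $(\epsilon,\delta/M^{d-1})$ on the line $\{l\}\times[0,1]$, with output $g_l$. For $r\in\{0,\dots,\frac M\gamma-1\}^{d-1}$ let $I_r=\prod_i[\frac{r_i\gamma}M,\frac{(r_i+1)\gamma}M]$ and output $g(\tilde{\boldsymbol x})=\sum_r\mathbb 1[\tilde{\boldsymbol x}\in I_r]\sum_{l\in I_r}g_l\,Q_{r,l}(\tilde{\boldsymbol x})$, where $Q_{r,l}(\tilde{\boldsymbol x})=\prod_{i=1}^{d-1}\prod_{0\le j\le\gamma,\ j\ne Ml_i-\gamma r_i}\frac{\tilde x_i-(\gamma r_i+j)/M}{l_i-(\gamma r_i+j)/M}$. **Theorem.** Admissible absolute constants $D_0$ and $D_1$ exist. Moreover there is an absolute integer $p\ge 0$ such that for all admissible $D_0,D_1$, all $c\in(0,1)$ and all $B>0$ there is a constant $C>0$, depending only on $D_0,D_1,c,B$, with the following property. Let $d\ge2$, let $\gamma\ge1$ be an integer, let $\epsilon,\delta\in(0,1)$, and let $M\ge1$ be a multiple of $\gamma$ with $M\le B\,\epsilon^{-1/\gamma}$. If Condition 1 and Condition 3 (with $f$ and $c$)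 hold, then with probability at least $1-\delta$ Algorithm 2 terminates and makes at most $$C\,\Bigl(\bigl(1+\ln\tfrac1\epsilon\bigr)\bigl(1+\ln\tfrac1\delta\bigr)\bigl(1+\ln d\bigr)\Bigr)^{p}\;\frac{d}{f(\epsilon/2)}\;B^{d-1}\,\epsilon^{-\frac{d-1}\gamma}$$ queries; that is, $\tilde O\bigl(\frac d{f(\epsilon/2)}\epsilon^{-\frac{d-1}\gamma}\bigr)$ queries, where $B^{d-1}$ is the $(d-1)$-st power of the constant in $M=\Theta(\epsilon^{-1/\gamma})$. -/

import Mathlib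

open MeasureTheory ProbabilityTheory

noncomputable section

/-! ## Labelers -/

/-- A response of the labeler: one of the labels `0`, `1`, or an abstention `⊥`. -/
inductive Response
  | zero
  | one
  | abstain

instance : MeasurableSpace Response := ⊤

instance : DiscreteMeasurableSpace Response := ⟨fun _ => trivial⟩

/-- A point of `ℝ^d`, written as `(x̃, x_d)` with `x̃ ∈ ℝ^(d-1)` and `x_d ∈ ℝ`. -/
abbrev Point (d : ℕ) : Type := (Fin (d - 1) → ℝ) × ℝ

/-- The unit cube `[0,1]^(d-1)`. -/
def unitCube (d : ℕ) : Set (Fin (d - 1) → ℝ) := Set.Icc 0 1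

/-- A labeler: for every instance `x` the response distribution `P(Y = · ∣ X = x)`. -/
abbrev Labeler (d : ℕ) : Type := Point d → PMF Response

open Classical in
/-- The true label `𝟙[x_d > g(x̃)]` of `x`, for the decision boundary `g`. -/
def trueLabel {d : ℕ} (g : (Fin (d - 1) → ℝ) → ℝ) (x : Point d) : Response :=
  if g x.1 < x.2 then Response.one else Response.zero

/-- The first condition on the labeler: abstention does not increase when one moves away
from the boundary, and a non-abstaining response is wrong with probability at most `1/2`
(no requirement where the labeler abstains almost surely). -/
structure MonotoneCondition {d : ℕ} (g : (Fin (d - 1) → ℝ) → ℝ) (P : Labeler d) : Prop where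
  abstention : ∀ x ∈ unitCube d, ∀ y ∈ Set.Icc (0 : ℝ) 1, ∀ y' ∈ Set.Icc (0 : ℝ) 1,
    |y' - g x| ≤ |y - g x| → P (x, y) Response.abstain ≤ P (x, y') Response.abstain
  noise : ∀ x ∈ unitCube d, ∀ y ∈ Set.Icc (0 : ℝ) 1,
    cond (P (x, y)).toMeasure {r | r ≠ Response.abstain} {r | r ≠ trueLabel g (x, y)} ≤ 1 / 2

/-- The third condition on the labeler, with shape function `f : [0,1] → [0,1]` and
constant `c`: the abstention rate is exactly `1 - f(|x_d - g(x̃)|)`, where `f` is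
nondecreasing and `f(b) / f(a) ≤ 1 - c` whenever `0 < a ≤ 1` and `0 ≤ b ≤ 2a/3`
(the quotient presupposes `f(a) ≠ 0`, that is, `f(a) > 0`). -/
structure ShapeCondition {d : ℕ} (g : (Fin (d - 1) → ℝ) → ℝ) (f : ℝ → ℝ) (c : ℝ)
    (P : Labeler d) : Prop where
  mapsTo : Set.MapsTo f (Set.Icc 0 1) (Set.Icc 0 1)
  monotone : MonotoneOn f (Set.Icc 0 1)
  pos : ∀ a : ℝ, 0 < a → a ≤ 1 → 0 < f a
  ratio : ∀ a : ℝ, 0 < a → a ≤ 1 → ∀ b : ℝ, 0 ≤ b → b ≤ 2 / 3 * a → f b / f a ≤ 1 - c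
  abstention : ∀ x ∈ unitCube d, ∀ y ∈ Set.Icc (0 : ℝ) 1,
    (P (x, y) Response.abstain).toReal = 1 - f |y - g x|

/-! ## The sequential tests -/

/-- `[ln ln]₊(x) = ln ln max{x, e^e}`. -/
def lnlnPlus (x : ℝ) : ℝ := Real.log (Real.log (max x (Real.exp (Real.exp 1))))

/-- The threshold `p(n, δ)`. -/
def meanThreshold (D₀ : ℝ) (n : ℕ) (δ : ℝ) : ℝ :=
  D₀ * (1 + Real.log (1 / δ) + √(4 * n * (lnlnPlus (4 * n) + Real.log (1 / δ))))

/-- `CheckSignificant(X, δ)`. -/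
def CheckSignificant (D₀ : ℝ) (X : List ℝ) (δ : ℝ) : Prop :=
  meanThreshold D₀ X.length δ ≤ X.sum

/-- The empirical variance `n/(n-1) · (∑ Xᵢ² - (∑ Xᵢ)²/n)`, where `n` is the length of `X`. -/
def empiricalVariance (X : List ℝ) : ℝ :=
  (X.length : ℝ) / ((X.length : ℝ) - 1) *
    ((X.map fun x => x ^ 2).sum - 1 / (X.length : ℝ) * X.sum ^ 2)

/-- The threshold `q(n, V, δ)` (it does not depend on `n`). -/
def varThreshold (D₁ V δ : ℝ) : ℝ :=
  D₁ * (1 + Real.log (1 / δ) + √((V + Real.log (1 / δ) + 1) *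
    (lnlnPlus (V + Real.log (1 / δ) + 1) + Real.log (1 / δ))))

/-- `CheckSignificant-Var(X, δ)`. -/
def CheckSignificantVar (D₁ : ℝ) (X : List ℝ) (δ : ℝ) : Prop :=
  Real.log (1 / δ) ≤ X.length ∧ varThreshold D₁ (empiricalVariance X) δ ≤ X.sum

/-- `X₀, X₁, …` are i.i.d. random variables with values in `[-2,2]` and mean zero. -/
structure IsCenteredIID {Ω : Type} [MeasurableSpace Ω] (μ : Measure Ω)
    (X : ℕ → Ω → ℝ) : Prop where
  measurable : ∀ i, Measurable (X i)
  indep : iIndepFun X μ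
  ident : ∀ i, IdentDistrib (X i) (X 0) μ μ
  bounded : ∀ i ω, X i ω ∈ Set.Icc (-2 : ℝ) 2
  centered : ∫ ω, X 0 ω ∂μ = 0

/-- The list `[X₀(ω), …, X₍ₙ₋₁₎(ω)]`. -/
def sampleList {Ω : Type} (X : ℕ → Ω → ℝ) (n : ℕ) (ω : Ω) : List ℝ :=
  (List.range n).map fun i => X i ω

/-- `D₀` is an admissible absolute constant for `CheckSignificant`: for every centered i.i.d.
sequence in `[-2,2]` and every `δ ∈ (0,1)`, with probability at least `1 - δ`,
`|∑_{i ≤ n} Xᵢ| ≤ p(n, δ)` for all `n > 0` simultaneously. -/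
def IsMeanConstant (D₀ : ℝ) : Prop :=
  ∀ (Ω : Type) [MeasurableSpace Ω] (μ : Measure Ω) [IsProbabilityMeasure μ] (X : ℕ → Ω → ℝ),
    IsCenteredIID μ X → ∀ δ : ℝ, 0 < δ → δ < 1 →
      ENNReal.ofReal (1 - δ) ≤
        μ {ω | ∀ n : ℕ, 0 < n → |(sampleList X n ω).sum| ≤ meanThreshold D₀ n δ}

/-- `D₁` is an admissible absolute constant for `CheckSignificant-Var`: for every centered
i.i.d. sequence in `[-2,2]` and every `δ ∈ (0,1)`, with probability at least `1 - δ`,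
`|∑_{i ≤ n} Xᵢ| ≤ q(n, Vₙ, δ)` for all `n ≥ ln(1/δ)` simultaneously, where `Vₙ` is the
empirical variance of the first `n` terms. -/
def IsVarConstant (D₁ : ℝ) : Prop :=
  ∀ (Ω : Type) [MeasurableSpace Ω] (μ : Measure Ω) [IsProbabilityMeasure μ] (X : ℕ → Ω → ℝ),
    IsCenteredIID μ X → ∀ δ : ℝ, 0 < δ → δ < 1 →
      ENNReal.ofReal (1 - δ) ≤
        μ {ω | ∀ n : ℕ, Real.log (1 / δ) ≤ n →
          |(sampleList X n ω).sum| ≤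
            varThreshold D₁ (empiricalVariance (sampleList X n ω)) δ}

/-! ## The one-dimensional algorithm -/

/-- The three query positions in an interval: `U`, `M`, `V`. -/
inductive Quartile
  | u
  | m
  | v

/-- The position of a quartile in the interval `[I.1, I.2]`. -/
def quartile (I : ℝ × ℝ) : Quartile → ℝ
  | .u => (3 * I.1 + I.2) / 4
  | .m => (I.1 + I.2) / 2
  | .v => (I.1 + 3 * I.2) / 4

/-- The entry of the array `A` for a response: `1` for a label, `0` for an abstention. -/
def answeredValue : Response → ℝ
  | .zero => 1
  | .one => 1
  | .abstain => 0

/-- The entry of the array `B` for a response: `-1` or `1` for a label, none for an abstention. -/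
def labelValue? : Response → Option ℝ
  | .zero => some (-1)
  | .one => some 1
  | .abstain => none

/-- The array `A^(w)` after `n` iterations; `ans i w` is the response to the query at
quartile `w` in iteration `i + 1`. -/
def arrayA (ans : ℕ → Quartile → Response) (w : Quartile) (n : ℕ) : List ℝ :=
  (List.range n).map fun i => answeredValue (ans i w)

/-- The array `B^(w)` after `n` iterations. -/
def arrayB (ans : ℕ → Quartile → Response) (w : Quartile) (n : ℕ) : List ℝ :=
  (List.range n).filterMap fun i => labelValue? (ans i w)

/-- The differences `A^(w)_i - A^(m)_i`, `i ≤ n`. -/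
def diffA (ans : ℕ → Quartile → Response) (w : Quartile) (n : ℕ) : List ℝ :=
  List.zipWith (fun a b => a - b) (arrayA ans w n) (arrayA ans .m n)

open Classical in
/-- The tests at the end of iteration `n` in the interval `I = [L, R]`, each at confidence
level `η`: the next interval if one of them succeeds, `none` if the inner loop goes on. -/
def iterationTest (D₀ D₁ η : ℝ) (I : ℝ × ℝ) (ans : ℕ → Quartile → Response) (n : ℕ) :
    Option (ℝ × ℝ) :=
  if CheckSignificantVar D₁ (diffA ans .u n) η then some (quartile I .u, I.2)
  else if CheckSignificantVar D₁ (diffA ans .v n) η then some (I.1, quartile I .v)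
  else if CheckSignificant D₀ ((arrayB ans .u n).map fun b => -b) η then
    some (quartile I .u, I.2)
  else if CheckSignificant D₀ (arrayB ans .v n) η then some (I.1, quartile I .v)
  else none

open Classical in
/-- One pass of the outer loop: the first iteration `n ≥ 1` at which a test succeeds determines
the next interval, and `3n` queries have been made. The value is `none` if there is no such
iteration, in which case the inner loop runs (and queries) forever. -/
def searchRound (D₀ D₁ η : ℝ) (I : ℝ × ℝ) (ans : ℕ → Quartile → Response) :
    Option ((ℝ × ℝ) × ℕ) :=
  if h : ∃ n : ℕ, 1 ≤ n ∧ (iterationTest D₀ D₁ η I ans n).isSome then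
    (iterationTest D₀ D₁ η I ans (Nat.find h)).map fun J => (J, 3 * Nat.find h)
  else none

/-- The number of passes of the outer loop, `log_{4/3} (1/(2ε))`, rounded up. -/
def numRounds (ε : ℝ) : ℕ := ⌈Real.logb (4 / 3) (1 / (2 * ε))⌉₊

/-- The state (interval and number of queries so far) after `k` passes of the outer loop;
`none` if one of them does not terminate. Here `resp j i w y` is the response to the query
made in pass `j`, iteration `i + 1`, at quartile `w`, if this quartile is the point `y`. -/
def thresholdSearch (D₀ D₁ ε δ : ℝ) (resp : ℕ → ℕ → Quartile → ℝ → Response) :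
    ℕ → Option ((ℝ × ℝ) × ℕ)
  | 0 => some ((0, 1), 0)
  | k + 1 => (thresholdSearch D₀ D₁ ε δ resp k).bind fun s =>
      (searchRound D₀ D₁ (δ / (4 * numRounds ε)) s.1
        fun i w => resp k i w (quartile s.1 w)).map fun r => (r.1, s.2 + r.2)

/-- The algorithm for thresholds with parameters `ε`, `δ`: its output `θ̂` and the number of
queries it makes, or `none` if it does not terminate. -/
def algorithmOne (D₀ D₁ ε δ : ℝ) (resp : ℕ → ℕ → Quartile → ℝ → Response) : Option (ℝ × ℕ) :=
  (thresholdSearch D₀ D₁ ε δ resp (numRounds ε)).map fun s => ((s.1.1 + s.1.2) / 2, s.2)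

/-! ## The multidimensional algorithm -/

/-- Index set of the grid `{0/M, 1/M, …, (M-1)/M}^(d-1)`. -/
abbrev GridIndex (d M : ℕ) : Type := Fin (d - 1) → Fin M

/-- The grid point with index `l`. -/
def gridPoint {d M : ℕ} (l : GridIndex d M) : Fin (d - 1) → ℝ := fun i => ((l i : ℕ) : ℝ) / M

/-- The closed cell `I_q = ∏ᵢ [qᵢγ/M, (qᵢ+1)γ/M]`. -/
def cell {d M γ : ℕ} (q : Fin (d - 1) → Fin (M / γ)) : Set (Fin (d - 1) → ℝ) :=
  {x | ∀ i, ((q i : ℕ) : ℝ) * γ / M ≤ x i ∧ x i ≤ (((q i : ℕ) : ℝ) + 1) * γ / M}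

/-- The interpolation polynomial
`Q_{q,l}(x) = ∏ᵢ ∏_{0 ≤ j ≤ γ, j ≠ M lᵢ - γ qᵢ} (xᵢ - (γqᵢ+j)/M) / (lᵢ - (γqᵢ+j)/M)`. -/
def basisPoly {d M γ : ℕ} (q : Fin (d - 1) → Fin (M / γ)) (l : GridIndex d M)
    (x : Fin (d - 1) → ℝ) : ℝ :=
  ∏ i, ∏ j ∈ (Finset.range (γ + 1)).filter (fun j => γ * (q i : ℕ) + j ≠ (l i : ℕ)),
    (x i - ((γ * (q i : ℕ) + j : ℕ) : ℝ) / M) /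
      (gridPoint l i - ((γ * (q i : ℕ) + j : ℕ) : ℝ) / M)

open Classical in
/-- The interpolated boundary `∑_q g_q(x) 𝟙[x ∈ I_q]`, `g_q = ∑_{l ∈ I_q} g_l Q_{q,l}`. -/
def interpolate {d M : ℕ} (γ : ℕ) (θ : GridIndex d M → ℝ) (x : Fin (d - 1) → ℝ) : ℝ :=
  ∑ q : Fin (d - 1) → Fin (M / γ), (cell q).indicator
    (fun x => ∑ l ∈ Finset.univ.filter (fun l : GridIndex d M => gridPoint l ∈ cell q),
      θ l * basisPoly q l x) x

/-- A potential query of the multidimensional algorithm: in the run at the grid point `run`,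
in pass `round` of the outer loop and iteration `iter + 1` of the inner loop, the query at
quartile `pos`, in the case that this quartile is the point `height`. -/
structure QueryIndex (d M : ℕ) where
  run : GridIndex d M
  round : ℕ
  iter : ℕ
  pos : Quartile
  height : ℝ

/-- The law of the responses. For each potential query there is a response, drawn from the
response distribution at the queried point, and all of these are independent. An execution of
the algorithm reads the entry of an index `(run, round, iter, pos)` at one `height` only,
determined by entries read before; so every response that it receives is drawn from
`P(· ∣ x)`, `x` the queried point, independently of the past. -/
def responseLaw {d : ℕ} (P : Labeler d) (M : ℕ) : Measure (QueryIndex d M → Response) :=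
  Measure.infinitePi fun q => (P (gridPoint q.run, q.height)).toMeasure

/-- The result of the run of the one-dimensional algorithm at the grid point `l`, with
parameters `ε` and `δ / M^(d-1)`. -/
def gridRun {d : ℕ} (D₀ D₁ ε δ : ℝ) (M : ℕ) (ω : QueryIndex d M → Response)
    (l : GridIndex d M) : Option (ℝ × ℕ) :=
  algorithmOne D₀ D₁ ε (δ / (M : ℝ) ^ (d - 1)) fun k i w y => ω ⟨l, k, i, w, y⟩

open Classical in
/-- The multidimensional algorithm: its output boundary and the total number of queries it
makes, or `none` if it does not terminate. -/
def algorithmTwo {d : ℕ} (D₀ D₁ ε δ : ℝ) (γ M : ℕ) (ω : QueryIndex d M → Response) :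
    Option (((Fin (d - 1) → ℝ) → ℝ) × ℕ) :=
  if h : ∀ l, (gridRun D₀ D₁ ε δ M ω l).isSome then
    some (interpolate γ fun l => ((gridRun D₀ D₁ ε δ M ω l).get (h l)).1,
      ∑ l, ((gridRun D₀ D₁ ε δ M ω l).get (h l)).2)
  else none

end

/-! The core is a self-normalized law of the iterated logarithm. For `|l X| ≤ 1/2` one has `E exp(l
X - l² X²) ≤ 1 + l E X`, so for centered `X` the products of these exponentials form a nonnegative
supermartingale, and Ville's inequality controls `l S - l² W` for all `n` at once, where `S` is the
sum and `W` the sum of squares. A union over dyadic ranges of `W + ln(1/δ) + 1`, each with its own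
tilt `l`, gives `|S| ≤ 30 * deviationBound W (ln(1/δ))`. Comparing `W` with `4n`, or with the
empirical variance, yields admissible `D₀` and `D₁`.

For the query bound, fix one pass on an interval containing the boundary point `θ`. If `θ` lies left
of the midpoint, then the midpoint is at most `2/3` as far from `θ` as `V` is, and `V` is at
distance at least a quarter of the length. The shape condition then makes the answer rate `a` at `V`
exceed the rate at the midpoint by at least `c a`; as the variance is also of order `a`, the
variance test fires after about `ln(1/η) / a` iterations (`roundLaw_not_checkSignificantVar_le`).
The right half is symmetric. A cut loses `θ` only if `θ` is beyond the quartile in question, and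
then the statistics of both tests there have nonpositive mean, so admissibility makes this cut
unlikely. Hence a pass fails with probability at most `4η` (`labelerRoundLaw_not_roundSucceeds_le`).

The interval before a pass depends only on earlier passes and takes finitely many values, so the
pass sees fresh responses and failures add up over passes and grid lines. Every pass starts from a
length above `2ε`, whence `a ≥ f(ε/2)`; the factor `d` comes from `ln(1/η)`, through the confidence
`δ / M^(d-1)` per line. -/

noncomputable section

/-! ## A maximal inequality for products of independent variables -/

/-- Ville's inequality for partial sums of independent variables with `E exp Zᵢ ≤ 1`. -/
theorem measure_exists_le_sum_le_exp_neg {Ω : Type*} [mΩ : MeasurableSpace Ω] {μ : Measure Ω}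
    [IsProbabilityMeasure μ] {Z : ℕ → Ω → ℝ} (hm : ∀ i, Measurable (Z i))
    (hi : iIndepFun Z μ) (hZ : ∀ i, ∫⁻ ω, ENNReal.ofReal (Real.exp (Z i ω)) ∂μ ≤ 1) (a : ℝ) :
    μ {ω | ∃ n, a ≤ ∑ i ∈ Finset.range n, Z i ω} ≤ ENNReal.ofReal (Real.exp (-a)) := by
  set t := ENNReal.ofReal (Real.exp a) with ht
  let F : ℕ → MeasurableSpace Ω := fun n =>
    ⨆ i ∈ {i | i < n}, MeasurableSpace.comap (Z i) inferInstance
  have hF : ∀ n, F n ≤ mΩ := fun n => iSup₂_le fun i _ => (hm i).comap_le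
  let M : ℕ → Ω → ENNReal := fun n ω => ENNReal.ofReal (Real.exp (∑ i ∈ Finset.range n, Z i ω))
  have hZF : ∀ n i, i < n → Measurable[F n] (Z i) := fun n i h =>
    Measurable.of_comap_le (le_iSup₂_of_le i h le_rfl)
  have hSF : ∀ n m, m ≤ n → Measurable[F n] (fun ω => ∑ i ∈ Finset.range m, Z i ω) :=
    fun n m h => Finset.measurable_fun_sum _ fun i hi => hZF n i
      ((Finset.mem_range.1 hi).trans_le h)
  have hMF : ∀ n, Measurable[F n] (M n) := fun n =>
    ENNReal.measurable_ofReal.comp (Real.measurable_exp.comp (hSF n n le_rfl))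
  let A : ℕ → Set Ω := fun N => {ω | ∃ n < N, a ≤ ∑ i ∈ Finset.range n, Z i ω}
  -- `A (N + 1)` involves sums of at most `N` terms, so it is decided before `Z N` is seen.
  have hA : ∀ N, MeasurableSet[F N] (A (N + 1)) := by
    intro N
    have : A (N + 1) = ⋃ n ∈ Finset.range (N + 1), {ω | a ≤ ∑ i ∈ Finset.range n, Z i ω} := by
      ext ω; simp [A]
    rw [this]
    exact Finset.measurableSet_biUnion _ fun n hn =>
      measurableSet_le (@measurable_const _ _ _ (F N) a)
        (hSF N n (Nat.lt_succ_iff.1 (Finset.mem_range.1 hn)))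
  have hA' : ∀ N, MeasurableSet (A N) := by
    intro N
    cases N with
    | zero => simp [A]
    | succ N => exact hF N _ (hA N)
  -- The supermartingale stopped at its first crossing: paths that have crossed are frozen at value
  -- `t = exp a`, the others still carry `M N`.
  have hstep : ∀ N, ∫⁻ ω in (A N)ᶜ, M N ω ∂μ + t * μ (A N) ≤ 1 := by
    intro N
    induction N with
    | zero => simp [A, M]
    | succ N ih =>
      refine le_trans ?_ ih
      have h1 : ∫⁻ ω in (A (N + 1))ᶜ, M (N + 1) ω ∂μ ≤ ∫⁻ ω in (A (N + 1))ᶜ, M N ω ∂μ := by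
        rw [← lintegral_indicator (hA' _).compl, ← lintegral_indicator (hA' _).compl]
        have : ∀ ω, (A (N + 1))ᶜ.indicator (M (N + 1)) ω =
            (A (N + 1))ᶜ.indicator (M N) ω * ENNReal.ofReal (Real.exp (Z N ω)) := by
          intro ω
          by_cases h : ω ∈ (A (N + 1))ᶜ
          · simp only [Set.indicator_of_mem h, M]
            rw [Finset.sum_range_succ, Real.exp_add, ENNReal.ofReal_mul (Real.exp_pos _).le]
          · simp [Set.indicator_of_notMem h]
        simp_rw [this]
        have hind : Indep (F N) (MeasurableSpace.comap (Z N) inferInstance) μ := by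
          have := indep_iSup_of_disjoint (fun i => (hm i).comap_le) hi
            (S := {i | i < N}) (T := {N}) (by simp)
          simpa [F] using this
        rw [lintegral_mul_eq_lintegral_mul_lintegral_of_independent_measurableSpace (hF N)
          (hm N).comap_le hind ((hMF N).indicator (hA N).compl)
          (g := fun ω => ENNReal.ofReal (Real.exp (Z N ω)))
          (ENNReal.measurable_ofReal.comp
            (Real.measurable_exp.comp (Measurable.of_comap_le le_rfl)))]
        exact mul_le_of_le_one_right' (hZ N)
      have hsub : A N ⊆ A (N + 1) := fun ω ⟨n, hn, h⟩ => ⟨n, hn.trans (Nat.lt_succ_self _), h⟩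
      have h2 : ∫⁻ ω in (A N)ᶜ, M N ω ∂μ =
          ∫⁻ ω in (A (N + 1))ᶜ, M N ω ∂μ + ∫⁻ ω in A (N + 1) \ A N, M N ω ∂μ := by
        rw [← lintegral_union ((hA' _).diff (hA' _))]
        · congr 2
          ext ω
          have := @hsub ω
          simp only [Set.mem_compl_iff, Set.mem_union, Set.mem_sdiff]
          tauto
        · rw [Set.disjoint_left]
          exact fun ω h h' => h h'.1
      -- Here the first crossing happens exactly at `n = N`, so `M N ≥ t`.
      have h3 : t * μ (A (N + 1) \ A N) ≤ ∫⁻ ω in A (N + 1) \ A N, M N ω ∂μ := by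
        rw [← setLIntegral_const]
        refine setLIntegral_mono' ((hA' _).diff (hA' _)) fun ω hω => ?_
        obtain ⟨⟨n, hn, h⟩, h'⟩ := hω
        have : n = N := by
          by_contra hne
          exact h' ⟨n, by omega, h⟩
        subst this
        exact ENNReal.ofReal_le_ofReal (Real.exp_le_exp.2 h)
      have h4 : μ (A (N + 1)) = μ (A (N + 1) \ A N) + μ (A N) := by
        rw [← measure_union Set.disjoint_sdiff_left (hA' N), Set.sdiff_union_of_subset hsub]
      rw [h4, h2, mul_add, ← add_assoc]
      gcongr
  have hbound : ∀ N, μ (A N) ≤ ENNReal.ofReal (Real.exp (-a)) := by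
    intro N
    have h1 : t * μ (A N) ≤ 1 := le_trans le_add_self (hstep N)
    rw [Real.exp_neg, ENNReal.ofReal_inv_of_pos (Real.exp_pos _), ← ht]
    exact ENNReal.le_inv_iff_mul_le.2 (by rwa [mul_comm])
  have hU : {ω | ∃ n, a ≤ ∑ i ∈ Finset.range n, Z i ω} = ⋃ N, A N := by
    ext ω
    simp only [Set.mem_ofPred_eq, Set.mem_iUnion, A]
    exact ⟨fun ⟨n, h⟩ => ⟨n + 1, n, Nat.lt_succ_self n, h⟩, fun ⟨_, n, _, h⟩ => ⟨n, h⟩⟩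
  have hmono : Monotone A := fun N N' h ω ⟨n, hn, h'⟩ => ⟨n, hn.trans_le h, h'⟩
  rw [hU, hmono.measure_iUnion]
  exact iSup_le hbound

/-- `log (1 + y) - y + y²` has derivative `y (1 + 2y) / (1 + y)`, whose only sign change on this
range is at `0`, where the function attains its minimum `0`. -/
theorem Real.exp_sub_sq_le_one_add {y : ℝ} (hy : -(1 / 2) ≤ y) : Real.exp (y - y ^ 2) ≤ 1 + y := by
  have h1 : (0 : ℝ) < 1 + y := by linarith
  have hd : ∀ x : ℝ, 0 < 1 + x → HasDerivAt (fun y : ℝ => Real.log (1 + y) - y + y ^ 2)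
      (x * (1 + 2 * x) / (1 + x)) x := by
    intro x hx
    have h := ((((hasDerivAt_id x).const_add 1).log hx.ne').sub
      (hasDerivAt_id x)).add ((hasDerivAt_id x).pow 2)
    refine HasDerivAt.congr_deriv h ?_
    simp only [id]
    field_simp
    push_cast
    ring
  have hm : MonotoneOn (fun y : ℝ => Real.log (1 + y) - y + y ^ 2) (Set.Ici 0) := by
    have hp : ∀ x ∈ Set.Ici (0 : ℝ), 0 < 1 + x := fun x (hx : 0 ≤ x) => by positivity
    refine monotoneOn_of_deriv_nonneg (convex_Ici 0)
      (fun x hx => (hd x (hp x hx)).continuousAt.continuousWithinAt)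
      (fun x hx => (hd x (hp x (interior_subset hx))).differentiableAt.differentiableWithinAt)
      fun x hx => ?_
    have hx0 : 0 ≤ x := interior_subset hx
    rw [(hd x (hp x hx0)).deriv]
    positivity
  have ha : AntitoneOn (fun y : ℝ => Real.log (1 + y) - y + y ^ 2) (Set.Icc (-(1 / 2)) 0) := by
    have hp : ∀ x ∈ Set.Icc (-(1 / 2) : ℝ) 0, 0 < 1 + x := fun x hx => by linarith [hx.1]
    refine antitoneOn_of_deriv_nonpos (convex_Icc _ 0)
      (fun x hx => (hd x (hp x hx)).continuousAt.continuousWithinAt)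
      (fun x hx => (hd x (hp x (interior_subset hx))).differentiableAt.differentiableWithinAt)
      fun x hx => ?_
    have hx0 := interior_subset hx
    rw [(hd x (hp x hx0)).deriv]
    exact div_nonpos_of_nonpos_of_nonneg (mul_nonpos_of_nonpos_of_nonneg hx0.2
      (by linarith [hx0.1])) (hp x hx0).le
  have key : 0 ≤ Real.log (1 + y) - y + y ^ 2 := by
    rcases le_total 0 y with h | h
    · simpa using hm (Set.mem_Ici.2 le_rfl) h h
    · simpa using ha ⟨hy, h⟩ ⟨by norm_num, le_rfl⟩ h
  rw [← Real.le_log_iff_exp_le h1]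
  linarith

/-! ## Iterated logarithms -/

theorem exp_one_le_log_max (x : ℝ) : Real.exp 1 ≤ Real.log (max x (Real.exp (Real.exp 1))) :=
  (Real.le_log_iff_exp_le (by positivity)).2 (le_max_right _ _)

theorem one_le_lnlnPlus (x : ℝ) : 1 ≤ lnlnPlus x :=
  (Real.le_log_iff_exp_le ((Real.exp_pos 1).trans_le (exp_one_le_log_max x))).2
    (exp_one_le_log_max x)

theorem lnlnPlus_mono : Monotone lnlnPlus := fun x y h =>
  Real.log_le_log ((Real.exp_pos 1).trans_le (exp_one_le_log_max x))
    (Real.log_le_log (by positivity) (max_le_max_right _ h))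

theorem lnlnPlus_two_mul_le {x : ℝ} : lnlnPlus (2 * x) ≤ 2 * lnlnPlus x := by
  set m := max x (Real.exp (Real.exp 1)) with hm
  have hy := exp_one_le_log_max x
  have he : (2 : ℝ) ≤ Real.exp 1 := by linarith [Real.add_one_le_exp (1 : ℝ)]
  have h1 : max (2 * x) (Real.exp (Real.exp 1)) ≤ 2 * m := by
    have h2 := Real.exp_pos (Real.exp 1)
    exact max_le (by linarith [le_max_left x (Real.exp (Real.exp 1))])
      (by linarith [le_max_right x (Real.exp (Real.exp 1))])
  have hmpos : 0 < m := by positivity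
  have h2 : Real.log (max (2 * x) (Real.exp (Real.exp 1))) ≤ 2 * Real.log m := by
    refine (Real.log_le_log (by positivity) h1).trans ?_
    rw [Real.log_mul (by norm_num) hmpos.ne']
    linarith [Real.log_two_lt_d9]
  have h3 : lnlnPlus (2 * x) ≤ Real.log (2 * Real.log m) :=
    Real.log_le_log ((Real.exp_pos 1).trans_le (exp_one_le_log_max _)) h2
  rw [Real.log_mul (by norm_num) (by linarith)] at h3
  have h4 := one_le_lnlnPlus x
  change _ ≤ _ + lnlnPlus x at h3
  linarith [Real.log_two_lt_d9]

theorem lnlnPlus_le_max_one {x : ℝ} : lnlnPlus x ≤ max 1 x := by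
  rcases le_total x (Real.exp (Real.exp 1)) with h | h
  · simp [lnlnPlus, max_eq_right h]
  · refine le_max_of_le_right ?_
    rw [lnlnPlus, max_eq_left h]
    have hx : 0 < x := (Real.exp_pos _).trans_le h
    have h1 : 0 < Real.log x := (Real.exp_pos 1).trans_le ((Real.le_log_iff_exp_le hx).2 h)
    linarith [Real.log_le_sub_one_of_pos h1, Real.log_le_sub_one_of_pos hx]

theorem lnlnPlus_le_one_add_sqrt {x : ℝ} : lnlnPlus x ≤ 1 + 2 * √x := by
  rcases le_total x (Real.exp (Real.exp 1)) with h | h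
  · simp [lnlnPlus, max_eq_right h]
  · rw [lnlnPlus, max_eq_left h]
    have hx : 0 < x := (Real.exp_pos _).trans_le h
    have h1 : 0 < Real.log x := (Real.exp_pos 1).trans_le ((Real.le_log_iff_exp_le hx).2 h)
    have h2 := Real.log_le_sub_one_of_pos h1
    have h3 := Real.log_le_sub_one_of_pos (Real.sqrt_pos.2 hx)
    rw [Real.log_sqrt hx.le] at h3
    linarith

/-! ## A self-normalized law of the iterated logarithm -/

/-- The compensator is the observed square, not the variance, so no knowledge of the law beyond its
mean is needed. A nonzero mean is allowed because the detection bound uses this with drift. -/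
theorem lintegral_exp_sub_sq_le {Ω : Type*} [MeasurableSpace Ω] {μ : Measure Ω}
    [IsProbabilityMeasure μ] {X : Ω → ℝ} (hm : Measurable X) {b l : ℝ} (hb : ∀ ω, |X ω| ≤ b)
    (hl : |l| * b ≤ 1 / 2) :
    ∫⁻ ω, ENNReal.ofReal (Real.exp (l * X ω - l ^ 2 * X ω ^ 2)) ∂μ ≤
      ENNReal.ofReal (1 + l * ∫ ω, X ω ∂μ) := by
  have hi : Integrable X μ := Integrable.of_bound hm.aestronglyMeasurable b
    (Filter.Eventually.of_forall hb)
  have hy : ∀ ω, -(1 / 2) ≤ l * X ω := fun ω => by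
    have h : |l * X ω| ≤ 1 / 2 := by
      rw [abs_mul]
      exact (mul_le_mul_of_nonneg_left (hb ω) (abs_nonneg _)).trans hl
    exact (abs_le.1 h).1
  have h1 : ∫ ω, (1 + l * X ω) ∂μ = 1 + l * ∫ ω, X ω ∂μ := by
    rw [integral_add (integrable_const _) (hi.const_mul _), integral_const_mul]
    simp
  rw [← h1, ofReal_integral_eq_lintegral_ofReal (f := fun ω => 1 + l * X ω)
    ((integrable_const _).add (hi.const_mul _))
    (Filter.Eventually.of_forall fun ω => by
      have := hy ω
      change 0 ≤ 1 + l * X ω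
      linarith)]
  refine lintegral_mono fun ω => ENNReal.ofReal_le_ofReal ?_
  have := Real.exp_sub_sq_le_one_add (hy ω)
  rwa [mul_pow] at this

/-- The uniform deviation bound: `1 + Λ + √(T (ln ln T + Λ))` with `T = W + Λ + 1`. -/
def deviationBound (W Λ : ℝ) : ℝ :=
  1 + Λ + √((W + Λ + 1) * (lnlnPlus (W + Λ + 1) + Λ))

/-- The exponent used on the block `2^j ≤ T < 2^(j+1)`. -/
def blockLevel (Λ : ℝ) (j : ℕ) : ℝ := Λ + Real.log 2 + Real.log (((j : ℝ) + 1) * ((j : ℝ) + 2))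

/-- The exponential tilt used on the block `2^j ≤ T < 2^(j+1)`. -/
def blockTilt (Λ : ℝ) (j : ℕ) : ℝ := min (1 / 4) (√(blockLevel Λ j / 2 ^ j))

theorem blockLevel_pos {Λ : ℝ} (hΛ : 0 ≤ Λ) (j : ℕ) : 0 < blockLevel Λ j := by
  have h1 := Real.log_pos (by norm_num : (1 : ℝ) < 2)
  have h2 : (0 : ℝ) ≤ Real.log (((j : ℝ) + 1) * ((j : ℝ) + 2)) := by
    refine Real.log_nonneg ?_
    have : (0 : ℝ) ≤ j := j.cast_nonneg
    nlinarith
  unfold blockLevel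
  linarith

theorem blockTilt_pos {Λ : ℝ} (hΛ : 0 ≤ Λ) (j : ℕ) : 0 < blockTilt Λ j :=
  lt_min (by norm_num) (Real.sqrt_pos.2 (div_pos (blockLevel_pos hΛ j) (by positivity)))

/-- The block index is at most of order `log T`, so the price `log ((j + 1) (j + 2))` of the union
over blocks is an iterated logarithm of `T`. -/
theorem blockLevel_le {Λ : ℝ} (hΛ : 0 ≤ Λ) {j : ℕ} {T : ℝ} (hT : 2 ^ j ≤ T) :
    blockLevel Λ j ≤ 5 * (lnlnPlus T + Λ) := by
  have hT0 : 0 < T := lt_of_lt_of_le (by positivity) hT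
  set y := Real.log (max T (Real.exp (Real.exp 1))) with hy
  have hye : Real.exp 1 ≤ y := exp_one_le_log_max T
  have hy2 : (2.7 : ℝ) ≤ y := by linarith [Real.exp_one_gt_d9]
  have hj : (j : ℝ) * Real.log 2 ≤ y := by
    rw [← Real.log_pow]
    exact Real.log_le_log (by positivity) (hT.trans (le_max_left _ _))
  have hj0 : (0 : ℝ) ≤ j := j.cast_nonneg
  have hl2 := Real.log_two_gt_d9
  have hj3 : (j : ℝ) + 2 ≤ 3 * y := by nlinarith
  have h3 : Real.log (((j : ℝ) + 1) * ((j : ℝ) + 2)) ≤ 2 * (Real.log 3 + lnlnPlus T) := by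
    rw [Real.log_mul (by positivity) (by positivity)]
    have h4 : Real.log ((j : ℝ) + 2) ≤ Real.log 3 + lnlnPlus T := by
      rw [lnlnPlus, ← hy, ← Real.log_mul (by norm_num) (by linarith)]
      exact Real.log_le_log (by positivity) hj3
    have h5 : Real.log ((j : ℝ) + 1) ≤ Real.log ((j : ℝ) + 2) :=
      Real.log_le_log (by positivity) (by linarith)
    linarith
  -- From `3^5 = 243 ≤ 256 = 2^8`.
  have h6 : Real.log 3 ≤ 1.15 := by
    have : Real.log 3 ≤ Real.log (2 ^ (1.6 : ℝ)) := by
      refine Real.log_le_log (by norm_num) ?_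
      have : (3 : ℝ) = (3 ^ (5 : ℝ)) ^ (1 / 5 : ℝ) := by
        rw [← Real.rpow_mul (by norm_num)]; norm_num
      rw [this, show (2 : ℝ) ^ (1.6 : ℝ) = (2 ^ (8 : ℝ)) ^ (1 / 5 : ℝ) by
        rw [← Real.rpow_mul (by norm_num)]; norm_num]
      exact Real.rpow_le_rpow (by positivity) (by norm_num) (by norm_num)
    rw [Real.log_rpow (by norm_num)] at this
    linarith [Real.log_two_lt_d9]
  have h7 := one_le_lnlnPlus T
  unfold blockLevel
  linarith [Real.log_two_lt_d9]

theorem lnlnPlus_le_one_add_sqrt_mul {T Λ : ℝ} (hT : 0 ≤ T) (hΛ : 0 ≤ Λ) :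
    lnlnPlus T ≤ 1 + √(T * (lnlnPlus T + Λ)) := by
  have h0 := one_le_lnlnPlus T
  rcases le_max_iff.1 (lnlnPlus_le_max_one (x := T)) with h | h
  · linarith [Real.sqrt_nonneg (T * (lnlnPlus T + Λ))]
  · have : lnlnPlus T ≤ √(T * (lnlnPlus T + Λ)) := by
      refine Real.le_sqrt_of_sq_le ?_
      nlinarith
    linarith

/-- On the block of `T = W + Λ + 1`, the linear bound of that block implies the uniform one. -/
theorem le_deviationBound_of_block {Λ W S : ℝ} {j : ℕ} (hΛ : 0 ≤ Λ) (hW : 0 ≤ W)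
    (h1 : 2 ^ j ≤ W + Λ + 1) (h2 : W + Λ + 1 < 2 ^ (j + 1))
    (h : blockTilt Λ j * S - blockTilt Λ j ^ 2 * W < blockLevel Λ j) :
    S ≤ 30 * deviationBound W Λ := by
  set T := W + Λ + 1 with hT
  set a := blockLevel Λ j with ha
  set l := blockTilt Λ j with hl
  have hapos : 0 < a := blockLevel_pos hΛ j
  have hlpos : 0 < l := blockTilt_pos hΛ j
  have hT0 : 0 < T := by positivity
  have hp : (0 : ℝ) < 2 ^ j := by positivity
  have hal := blockLevel_le hΛ h1
  rw [← ha] at hal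
  have hs0 := Real.sqrt_nonneg (a * 2 ^ j)
  have hS : S < l * W + a / l := by
    have h3 : a / l * l = a := div_mul_cancel₀ _ hlpos.ne'
    nlinarith
  -- The tilt `√(a / 2^j)` balances `l * W` against `a / l` when `W` is of order `2^j`; the term `4
  -- * a` pays for capping it at `1 / 4`.
  have hA : a / l ≤ 4 * a + √(a * 2 ^ j) := by
    rcases min_choice (1 / 4) (√(a / 2 ^ j)) with h' | h'
    · have : l = 1 / 4 := h'
      rw [this]; linarith
    · have hl' : l = √(a / 2 ^ j) := h'
      have : a / l = √(a * 2 ^ j) := by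
        rw [div_eq_iff hlpos.ne', hl', ← Real.sqrt_mul (by positivity)]
        rw [show a * 2 ^ j * (a / 2 ^ j) = a ^ 2 by field_simp]
        exact (Real.sqrt_sq hapos.le).symm
      linarith
  have hB : l * W ≤ 2 * √(a * 2 ^ j) := by
    have h4 : l ≤ √(a / 2 ^ j) := min_le_right _ _
    have h5 : W ≤ 2 * 2 ^ j := by rw [pow_succ] at h2; linarith
    calc l * W ≤ √(a / 2 ^ j) * (2 * 2 ^ j) := mul_le_mul h4 h5 hW (Real.sqrt_nonneg _)
      _ = 2 * √(a * 2 ^ j) := by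
        have : √(a * 2 ^ j) = √(a / 2 ^ j) * 2 ^ j := by
          rw [show a * 2 ^ j = a / 2 ^ j * (2 ^ j) ^ 2 by field_simp,
            Real.sqrt_mul (by positivity), Real.sqrt_sq hp.le]
        rw [this]; ring
  have hC : √(a * 2 ^ j) ≤ 2.3 * √(T * (lnlnPlus T + Λ)) := by
    refine Real.sqrt_le_iff.2 ⟨by positivity, ?_⟩
    have h0 := one_le_lnlnPlus T
    rw [mul_pow, Real.sq_sqrt (by positivity)]
    have := mul_le_mul hal h1 hp.le (by positivity)
    nlinarith [mul_nonneg hT0.le (by linarith : 0 ≤ lnlnPlus T + Λ)]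
  -- Absorbs the bare iterated logarithm in `4 * a`; the total is at most `20 (1 + Λ) + 26.9 √(T
  -- (lnlnPlus T + Λ))`.
  have hD := lnlnPlus_le_one_add_sqrt_mul hT0.le hΛ
  have hs := Real.sqrt_nonneg (T * (lnlnPlus T + Λ))
  unfold deviationBound
  rw [← hT]
  linarith

/-- Block `j` receives error `δ / (2 (j + 1) (j + 2))`, a telescoping series. Only `δ / 2` is spent,
because both tails are needed. -/
theorem tsum_ofReal_exp_neg_blockLevel_le {δ : ℝ} (hδ : 0 < δ) :
    ∑' j, ENNReal.ofReal (Real.exp (-blockLevel (Real.log (1 / δ)) j)) ≤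
      ENNReal.ofReal (δ / 2) := by
  have h : ∀ j : ℕ, Real.exp (-blockLevel (Real.log (1 / δ)) j) =
      δ / 2 * (1 / ((j : ℝ) + 1) - 1 / ((j : ℝ) + 2)) := by
    intro j
    rw [blockLevel, ← Real.log_mul (by positivity) (by positivity),
      ← Real.log_mul (by positivity) (by positivity), Real.exp_neg,
      Real.exp_log (by positivity)]
    field_simp
    ring
  refine ENNReal.tsum_le_of_sum_range_le fun n => ?_
  rw [← ENNReal.ofReal_sum_of_nonneg fun _ _ => (Real.exp_pos _).le]
  refine ENNReal.ofReal_le_ofReal ?_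
  have hs : ∀ n : ℕ, ∑ j ∈ Finset.range n, (1 / ((j : ℝ) + 1) - 1 / ((j : ℝ) + 2)) =
      1 - 1 / ((n : ℝ) + 1) := by
    intro n
    induction n with
    | zero => simp
    | succ n ih =>
      rw [Finset.sum_range_succ, ih]
      push_cast
      ring
  simp_rw [h]
  rw [← Finset.mul_sum, hs]
  have : (0 : ℝ) ≤ 1 / ((n : ℝ) + 1) := by positivity
  nlinarith

/-- The block containing `W + Λ + 1` is random, so Ville's inequality is applied with the tilt of
every block and the errors are summed. -/
theorem measure_exists_deviationBound_lt_le {Ω : Type*} [MeasurableSpace Ω] {μ : Measure Ω}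
    [IsProbabilityMeasure μ] {X : ℕ → Ω → ℝ} (hm : ∀ i, Measurable (X i)) (hi : iIndepFun X μ)
    (hb : ∀ i ω, |X i ω| ≤ 2) (h0 : ∀ i, ∫ ω, X i ω ∂μ = 0) {δ : ℝ} (hδ : 0 < δ) (hδ1 : δ < 1) :
    μ {ω | ∃ n, 30 * deviationBound (∑ i ∈ Finset.range n, X i ω ^ 2) (Real.log (1 / δ)) <
      ∑ i ∈ Finset.range n, X i ω} ≤ ENNReal.ofReal (δ / 2) := by
  set Λ := Real.log (1 / δ) with hΛd
  have hΛ : 0 ≤ Λ := Real.log_nonneg (by rw [le_div_iff₀ hδ]; linarith)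
  let Z : ℕ → ℕ → Ω → ℝ := fun j i ω => blockTilt Λ j * X i ω - blockTilt Λ j ^ 2 * X i ω ^ 2
  have hsub : {ω | ∃ n, 30 * deviationBound (∑ i ∈ Finset.range n, X i ω ^ 2) Λ <
      ∑ i ∈ Finset.range n, X i ω} ⊆
      ⋃ j, {ω | ∃ n, blockLevel Λ j ≤ ∑ i ∈ Finset.range n, Z j i ω} := by
    rintro ω ⟨n, hn⟩
    have hW : 0 ≤ ∑ i ∈ Finset.range n, X i ω ^ 2 := Finset.sum_nonneg fun i _ => sq_nonneg _
    obtain ⟨j, h1, h2⟩ := exists_nat_pow_near (y := (2 : ℝ))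
      (by linarith : 1 ≤ ∑ i ∈ Finset.range n, X i ω ^ 2 + Λ + 1) (by norm_num)
    refine Set.mem_iUnion.2 ⟨j, n, ?_⟩
    by_contra hlt
    push Not at hlt
    refine absurd (le_deviationBound_of_block hΛ hW h1 h2 ?_) (not_le.2 hn)
    rwa [Finset.mul_sum, Finset.mul_sum, ← Finset.sum_sub_distrib]
  refine (measure_mono hsub).trans ((measure_iUnion_le _).trans
    ((ENNReal.tsum_le_tsum fun j => ?_).trans (tsum_ofReal_exp_neg_blockLevel_le hδ)))
  refine measure_exists_le_sum_le_exp_neg (fun i => by fun_prop) ?_ (fun i => ?_) _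
  · exact hi.comp (fun _ x => blockTilt Λ j * x - blockTilt Λ j ^ 2 * x ^ 2) (by fun_prop)
  · refine (lintegral_exp_sub_sq_le (hm i) (hb i) ?_).trans (by simp [h0 i])
    -- The cap `1 / 4` on the tilt times the bound `2` on `|X i|` is the required `1 / 2`.
    rw [abs_of_pos (blockTilt_pos hΛ j)]
    linarith [show blockTilt Λ j ≤ 1 / 4 from min_le_left _ _]

theorem sampleList_sum {Ω : Type} (X : ℕ → Ω → ℝ) (n : ℕ) (ω : Ω) :
    (sampleList X n ω).sum = ∑ i ∈ Finset.range n, X i ω := by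
  rw [sampleList, Finset.sum_range, ← List.sum_ofFn, List.ofFn_eq_map]
  rw [← List.map_coe_finRange_eq_range, List.map_map]
  rfl

/-- Only subadditivity is used, so `G` need not be measurable. -/
theorem ofReal_one_sub_le_of_compl {Ω : Type*} [MeasurableSpace Ω] {μ : Measure Ω}
    [IsProbabilityMeasure μ] {G : Set Ω} {δ : ℝ} (hδ : 0 ≤ δ) (h : μ Gᶜ ≤ ENNReal.ofReal δ) :
    ENNReal.ofReal (1 - δ) ≤ μ G := by
  have h1 : 1 ≤ μ G + μ Gᶜ := by
    rw [← measure_univ (μ := μ), ← Set.union_compl_self G]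
    exact measure_union_le _ _
  rw [ENNReal.ofReal_sub _ hδ, ENNReal.ofReal_one, tsub_le_iff_right]
  exact h1.trans (by gcongr)

/-- The self-normalized law of the iterated logarithm for bounded centered i.i.d. sequences. -/
theorem IsCenteredIID.ofReal_one_sub_le {Ω : Type} [MeasurableSpace Ω] {μ : Measure Ω}
    [IsProbabilityMeasure μ] {X : ℕ → Ω → ℝ} (hX : IsCenteredIID μ X) {δ : ℝ} (hδ : 0 < δ)
    (hδ1 : δ < 1) :
    ENNReal.ofReal (1 - δ) ≤ μ {ω | ∀ n, |∑ i ∈ Finset.range n, X i ω| ≤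
      30 * deviationBound (∑ i ∈ Finset.range n, X i ω ^ 2) (Real.log (1 / δ))} := by
  have hb : ∀ i ω, |X i ω| ≤ 2 := fun i ω => abs_le.2 (hX.bounded i ω)
  have h0 : ∀ i, ∫ ω, X i ω ∂μ = 0 := fun i => (hX.ident i).integral_eq.trans hX.centered
  have h1 := measure_exists_deviationBound_lt_le hX.measurable hX.indep hb h0 hδ hδ1
  have h2 := measure_exists_deviationBound_lt_le (μ := μ) (X := fun i ω => -X i ω)
    (fun i => (hX.measurable i).neg) (hX.indep.comp (fun _ x => -x) fun _ => measurable_neg)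
    (fun i ω => by simpa using hb i ω) (fun i => by rw [integral_neg, h0 i, neg_zero]) hδ hδ1
  refine ofReal_one_sub_le_of_compl hδ.le ?_
  have hsub : {ω | ∀ n, |∑ i ∈ Finset.range n, X i ω| ≤
      30 * deviationBound (∑ i ∈ Finset.range n, X i ω ^ 2) (Real.log (1 / δ))}ᶜ ⊆
      {ω | ∃ n, 30 * deviationBound (∑ i ∈ Finset.range n, X i ω ^ 2) (Real.log (1 / δ)) <
        ∑ i ∈ Finset.range n, X i ω} ∪
      {ω | ∃ n, 30 * deviationBound (∑ i ∈ Finset.range n, (-X i ω) ^ 2) (Real.log (1 / δ)) <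
        ∑ i ∈ Finset.range n, -X i ω} := by
    intro ω hω
    simp only [Set.mem_compl_iff, Set.mem_ofPred_eq, not_forall, not_le, lt_abs] at hω
    obtain ⟨n, h | h⟩ := hω
    · exact Or.inl ⟨n, h⟩
    · exact Or.inr ⟨n, by simpa using h⟩
  refine (measure_mono hsub).trans ((measure_union_le _ _).trans ((add_le_add h1 h2).trans ?_))
  rw [← ENNReal.ofReal_add (by positivity) (by positivity), add_halves]

/-! ### Existence of admissible constants. -/

theorem exists_isMeanConstant : ∃ D₀ : ℝ, IsMeanConstant D₀ := by
  refine ⟨60, fun Ω _ μ _ X hX δ hδ hδ1 => (hX.ofReal_one_sub_le hδ hδ1).trans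
    (measure_mono fun ω hω n _ => ?_)⟩
  have hω := hω n
  rw [sampleList_sum]
  set Λ := Real.log (1 / δ) with hΛd
  have hΛ : 0 ≤ Λ := Real.log_nonneg (by rw [le_div_iff₀ hδ]; linarith)
  have hb : ∀ i, |X i ω| ≤ 2 := fun i => abs_le.2 (hX.bounded i ω)
  have hW : ∑ i ∈ Finset.range n, X i ω ^ 2 ≤ 4 * n := by
    have : ∀ i ∈ Finset.range n, X i ω ^ 2 ≤ 4 := fun i _ => by
      rw [← sq_abs]; nlinarith [hb i, abs_nonneg (X i ω)]
    simpa [mul_comm] using Finset.sum_le_card_nsmul _ _ _ this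
  have hW0 : 0 ≤ ∑ i ∈ Finset.range n, X i ω ^ 2 := Finset.sum_nonneg fun i _ => sq_nonneg _
  have hS : |∑ i ∈ Finset.range n, X i ω| ≤ 2 * n := by
    refine (Finset.abs_sum_le_sum_abs _ _).trans ?_
    simpa [mul_comm] using Finset.sum_le_card_nsmul _ _ _ fun i (_ : i ∈ Finset.range n) => hb i
  have hs := Real.sqrt_nonneg (4 * n * (lnlnPlus (4 * n) + Λ))
  rw [meanThreshold, ← hΛd]
  -- For large `n` the normalizer `W + Λ + 1` is at most `2 * (4 * n)`; for small `n` the trivial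
  -- bound `2 * n` lies below `1 + Λ`.
  rcases le_total (Λ + 1) (4 * n) with h | h
  · have h2 : √((∑ i ∈ Finset.range n, X i ω ^ 2 + Λ + 1) *
        (lnlnPlus (∑ i ∈ Finset.range n, X i ω ^ 2 + Λ + 1) + Λ)) ≤
        2 * √(4 * n * (lnlnPlus (4 * n) + Λ)) := by
      have h3 : (∑ i ∈ Finset.range n, X i ω ^ 2 + Λ + 1) ≤ 2 * (4 * n) := by linarith
      have h4 := (lnlnPlus_mono h3).trans lnlnPlus_two_mul_le
      have h5 := one_le_lnlnPlus (4 * n)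
      have h6 := one_le_lnlnPlus (∑ i ∈ Finset.range n, X i ω ^ 2 + Λ + 1)
      refine Real.sqrt_le_iff.2 ⟨by positivity, ?_⟩
      rw [mul_pow, Real.sq_sqrt (by positivity)]
      have := mul_le_mul h3 (by linarith : lnlnPlus (∑ i ∈ Finset.range n, X i ω ^ 2 + Λ + 1) + Λ
        ≤ 2 * (lnlnPlus (4 * n) + Λ)) (by positivity) (by positivity)
      linarith
    rw [deviationBound] at hω
    linarith
  · linarith

theorem sum_sq_eq_of_empiricalVariance {X : List ℝ} (h : 2 ≤ X.length) :
    (X.map fun x => x ^ 2).sum =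
      (1 - 1 / (X.length : ℝ)) * empiricalVariance X + X.sum ^ 2 / X.length := by
  have h2 : (2 : ℝ) ≤ X.length := by exact_mod_cast h
  have h3 : (X.length : ℝ) - 1 ≠ 0 := by linarith
  rw [empiricalVariance]
  field_simp
  ring

/-- A bound normalized by the sum of squares implies one normalized by the empirical variance. -/
theorem le_deviationBound_of_variance {n : ℕ} {x V W Λ : ℝ} (hΛ : 0 ≤ Λ) (hV : 0 ≤ V)
    (hx : 0 ≤ x) (hxn : x ≤ 2 * n) (hW : W ≤ V + x ^ 2 / n)
    (h : x ≤ 30 * deviationBound W Λ) :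
    x ≤ 2 * 10 ^ 11 * deviationBound V Λ := by
  have hs := Real.sqrt_nonneg ((V + Λ + 1) * (lnlnPlus (V + Λ + 1) + Λ))
  unfold deviationBound at h ⊢
  have hl1 := one_le_lnlnPlus (V + Λ + 1)
  have hl2 := one_le_lnlnPlus (W + Λ + 1)
  -- Small `n` is covered by the trivial bound `2 * n`. Beyond it, `n ≥ 8 * 10 ^ 10` makes `√(8 *
  -- n)` at most `n / 10 ^ 5`, as used below.
  rcases le_total (n : ℝ) (10 ^ 11 * (1 + Λ)) with hn | hn
  · linarith
  have hn0 : (0 : ℝ) < n := by linarith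
  rcases le_total (x ^ 2 / n) (V + Λ + 1) with hc | hc
  · have h3 : W + Λ + 1 ≤ 2 * (V + Λ + 1) := by linarith
    have h4 := (lnlnPlus_mono h3).trans lnlnPlus_two_mul_le
    have h2 : √((W + Λ + 1) * (lnlnPlus (W + Λ + 1) + Λ)) ≤
        2 * √((V + Λ + 1) * (lnlnPlus (V + Λ + 1) + Λ)) := by
      refine Real.sqrt_le_iff.2 ⟨by positivity, ?_⟩
      rw [mul_pow, Real.sq_sqrt (by positivity)]
      have := mul_le_mul h3 (by linarith : lnlnPlus (W + Λ + 1) + Λ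
        ≤ 2 * (lnlnPlus (V + Λ + 1) + Λ)) (by positivity) (by positivity)
      linarith
    linarith
  -- If the squared mean dominates, the square root is at most `x / 60`; after the factor `30` it is
  -- absorbed by half of `x`, leaving `x ≤ 60 (1 + Λ)`.
  · have hT : W + Λ + 1 ≤ 2 * (x ^ 2 / n) := by linarith
    have hx2 : x ^ 2 / n ≤ 4 * n := by
      rw [div_le_iff₀ hn0]; nlinarith
    have hl3 : lnlnPlus (W + Λ + 1) ≤ 1 + 2 * √(8 * n) :=
      (lnlnPlus_mono (by linarith)).trans lnlnPlus_le_one_add_sqrt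
    have hs8 : √(8 * n) ≤ n / 10 ^ 5 := by
      refine Real.sqrt_le_iff.2 ⟨by positivity, ?_⟩
      rw [div_pow, le_div_iff₀ (by positivity)]
      nlinarith
    have h6 : lnlnPlus (W + Λ + 1) + Λ ≤ n / 10 ^ 4 := by linarith
    have h2 : √((W + Λ + 1) * (lnlnPlus (W + Λ + 1) + Λ)) ≤ x / 60 := by
      refine Real.sqrt_le_iff.2 ⟨by positivity, ?_⟩
      refine (mul_le_mul hT h6 (by positivity) (by positivity)).trans ?_
      rw [show 2 * (x ^ 2 / n) * (n / 10 ^ 4) = 2 / 10 ^ 4 * x ^ 2 by field_simp]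
      nlinarith [sq_nonneg x]
    linarith

theorem exists_isVarConstant : ∃ D₁ : ℝ, IsVarConstant D₁ := by
  refine ⟨2 * 10 ^ 11, fun Ω _ μ _ X hX δ hδ hδ1 => (hX.ofReal_one_sub_le hδ hδ1).trans
    (measure_mono fun ω hω n _ => ?_)⟩
  have hω := hω n
  change _ ≤ 2 * 10 ^ 11 * deviationBound _ _
  set Λ := Real.log (1 / δ) with hΛd
  have hΛ : 0 ≤ Λ := Real.log_nonneg (by rw [le_div_iff₀ hδ]; linarith)
  have hb : ∀ i, |X i ω| ≤ 2 := fun i => abs_le.2 (hX.bounded i ω)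
  have hlen : (sampleList X n ω).length = n := by simp [sampleList]
  have hW : ((sampleList X n ω).map fun x => x ^ 2).sum = ∑ i ∈ Finset.range n, X i ω ^ 2 := by
    rw [← sampleList_sum (fun i ω => X i ω ^ 2) n ω]
    simp [sampleList, Function.comp_def]
  have hW0 : 0 ≤ ∑ i ∈ Finset.range n, X i ω ^ 2 := Finset.sum_nonneg fun i _ => sq_nonneg _
  have hS : |∑ i ∈ Finset.range n, X i ω| ≤ 2 * n := by
    refine (Finset.abs_sum_le_sum_abs _ _).trans ?_
    simpa [mul_comm] using Finset.sum_le_card_nsmul _ _ _ fun i (_ : i ∈ Finset.range n) => hb i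
  have hcs : (∑ i ∈ Finset.range n, X i ω) ^ 2 ≤ n * ∑ i ∈ Finset.range n, X i ω ^ 2 := by
    simpa using sq_sum_le_card_mul_sum_sq (s := Finset.range n) (f := fun i => X i ω)
  rcases lt_or_ge n 2 with hn | hn
  -- For `n = 1` this rests on division by zero being zero; the sum is then trivially at most `2`.
  · have hV : empiricalVariance (sampleList X n ω) = 0 := by
      rw [empiricalVariance, hlen]
      interval_cases n <;> simp
    have h1 : (n : ℝ) ≤ 1 := by exact_mod_cast Nat.lt_succ_iff.1 hn
    rw [hV, sampleList_sum]
    have hs := Real.sqrt_nonneg ((0 + Λ + 1) * (lnlnPlus (0 + Λ + 1) + Λ))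
    unfold deviationBound
    linarith
  · have hn2 : (2 : ℝ) ≤ n := by exact_mod_cast hn
    have hV : 0 ≤ empiricalVariance (sampleList X n ω) := by
      rw [empiricalVariance, hlen, hW, sampleList_sum]
      refine mul_nonneg (div_nonneg (by linarith) (by linarith)) ?_
      rw [sub_nonneg, one_div_mul_eq_div, div_le_iff₀ (by linarith)]
      linarith
    have hWV := sum_sq_eq_of_empiricalVariance (hlen.symm ▸ hn)
    rw [hlen, hW, sampleList_sum] at hWV
    rw [sampleList_sum]
    refine le_deviationBound_of_variance hΛ hV (abs_nonneg _) hS ?_ hω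
    rw [sq_abs, hWV]
    have : 0 ≤ 1 / (n : ℝ) * empiricalVariance (sampleList X n ω) := by positivity
    linarith

/-! ## Error probabilities of the tests -/

/-- The injection `e` allows sampling along a subsequence, such as the iterations in which the
labeler answers. -/
theorem isCenteredIID_infinitePi {S : Type} [MeasurableSpace S] {κ : Measure S}
    [IsProbabilityMeasure κ] {h : S → ℝ} (hm : Measurable h)
    (hb : ∀ s, h s ∈ Set.Icc (-2 : ℝ) 2) (h0 : ∫ s, h s ∂κ = 0) {e : ℕ → ℕ}
    (he : Function.Injective e) :
    IsCenteredIID (Measure.infinitePi fun _ : ℕ => κ) fun i ω => h (ω (e i)) where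
  measurable i := by fun_prop
  indep := (iIndepFun_infinitePi (X := fun _ => h) (fun _ => hm)).precomp he
  ident i := by
    have hmap : ∀ i, (Measure.infinitePi fun _ : ℕ => κ).map (fun ω => h (ω i)) = κ.map h := by
      intro i
      conv_rhs => rw [← Measure.infinitePi_map_eval (fun _ : ℕ => κ) i,
        Measure.map_map hm (by fun_prop)]
      rfl
    exact ⟨(hm.comp (measurable_pi_apply _)).aemeasurable,
      (hm.comp (measurable_pi_apply _)).aemeasurable, by rw [hmap, hmap]⟩
  bounded i ω := hb _
  centered := by
    rw [← h0]
    conv_rhs => rw [← Measure.infinitePi_map_eval (fun _ : ℕ => κ) (e 0)]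
    rw [integral_map (measurable_pi_apply _).aemeasurable hm.aestronglyMeasurable]

theorem exists_isCenteredIID_abs_eq_one :
    ∃ X : ℕ → (ℕ → Bool) → ℝ, (∀ i ω, |X i ω| = 1) ∧
      IsCenteredIID (Measure.infinitePi fun _ : ℕ => (PMF.uniformOfFintype Bool).toMeasure) X := by
  refine ⟨_, ?_, isCenteredIID_infinitePi (h := fun b => if b then 1 else -1)
    (measurable_of_finite _) ?_ ?_ Function.injective_id⟩
  · intro i ω
    cases ω (id i) <;> simp
  · intro s
    cases s <;> norm_num
  · rw [PMF.integral_eq_sum]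
    simp

/-- A nonpositive constant gives nonpositive thresholds, which fair signs exceed surely at `n = 1`.
-/
theorem IsMeanConstant.pos {D₀ : ℝ} (hD : IsMeanConstant D₀) : 0 < D₀ := by
  obtain ⟨X, hX, hiid⟩ := exists_isCenteredIID_abs_eq_one
  by_contra hneg
  push Not at hneg
  have h := hD _ _ X hiid (1 / 2) (by norm_num) (by norm_num)
  have hempty : {ω | ∀ n : ℕ, 0 < n →
      |(sampleList X n ω).sum| ≤ meanThreshold D₀ n (1 / 2)} = ∅ := by
    ext ω
    simp only [Set.mem_ofPred_eq, Set.mem_empty_iff_false, iff_false, not_forall, not_le]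
    refine ⟨1, one_pos, ?_⟩
    have h1 : meanThreshold D₀ 1 (1 / 2) ≤ 0 := by
      refine mul_nonpos_of_nonpos_of_nonneg hneg ?_
      have : 0 ≤ Real.log (1 / (1 / 2)) := Real.log_nonneg (by norm_num)
      positivity
    rw [sampleList_sum]
    simp only [Finset.range_one, Finset.sum_singleton, hX]
    linarith
  rw [hempty, measure_empty, nonpos_iff_eq_zero, ENNReal.ofReal_eq_zero] at h
  norm_num at h

theorem IsVarConstant.pos {D₁ : ℝ} (hD : IsVarConstant D₁) : 0 < D₁ := by
  obtain ⟨X, hX, hiid⟩ := exists_isCenteredIID_abs_eq_one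
  by_contra hneg
  push Not at hneg
  have h := hD _ _ X hiid (1 / 2) (by norm_num) (by norm_num)
  have hl : 0 ≤ Real.log (1 / (1 / 2)) := Real.log_nonneg (by norm_num)
  have hempty : {ω | ∀ n : ℕ, Real.log (1 / (1 / 2)) ≤ n →
      |(sampleList X n ω).sum| ≤
        varThreshold D₁ (empiricalVariance (sampleList X n ω)) (1 / 2)} = ∅ := by
    ext ω
    simp only [Set.mem_ofPred_eq, Set.mem_empty_iff_false, iff_false, not_forall, not_le]
    have h2 : Real.log (1 / (1 / 2)) ≤ ((1 : ℕ) : ℝ) := by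
      have := Real.log_two_lt_d9
      norm_num at this ⊢
      linarith
    refine ⟨1, h2, ?_⟩
    have h1 : varThreshold D₁ (empiricalVariance (sampleList X 1 ω)) (1 / 2) ≤ 0 :=
      mul_nonpos_of_nonpos_of_nonneg hneg (by positivity)
    rw [sampleList_sum]
    simp only [Finset.range_one, Finset.sum_singleton, hX]
    linarith
  rw [hempty, measure_empty, nonpos_iff_eq_zero, ENNReal.ofReal_eq_zero] at h
  norm_num at h

theorem log_one_div_lt {δ δ' : ℝ} (hδ : 0 < δ) (h : δ < δ') :
    Real.log (1 / δ') < Real.log (1 / δ) :=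
  Real.log_lt_log (one_div_pos.2 (hδ.trans h)) (one_div_lt_one_div_of_lt hδ h)

theorem log_one_div_pos {δ : ℝ} (hδ : 0 < δ) (h : δ < 1) : 0 < Real.log (1 / δ) :=
  Real.log_pos (by rwa [lt_div_iff₀ hδ, one_mul])

/-- A test fires also on equality, which admissibility permits. Strictness separates firing at level
`δ` from the good event at any level `δ' > δ`. -/
theorem meanThreshold_lt {D₀ δ δ' : ℝ} (hD : 0 < D₀) (hδ : 0 < δ) (h : δ < δ') (n : ℕ) :
    meanThreshold D₀ n δ' < meanThreshold D₀ n δ := by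
  have h1 := log_one_div_lt hδ h
  have h2 : √(4 * n * (lnlnPlus (4 * n) + Real.log (1 / δ'))) ≤
      √(4 * n * (lnlnPlus (4 * n) + Real.log (1 / δ))) := by gcongr
  exact mul_lt_mul_of_pos_left (by linarith) hD

theorem varThreshold_lt {D₁ δ δ' : ℝ} (hD : 0 < D₁) (hδ : 0 < δ) (h : δ < δ') (hδ' : δ' < 1)
    (V : ℝ) : varThreshold D₁ V δ' < varThreshold D₁ V δ := by
  have h1 := log_one_div_lt hδ h
  have h0 := log_one_div_pos (hδ.trans h) hδ'
  have hl := one_le_lnlnPlus (V + Real.log (1 / δ') + 1)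
  have h2 : √((V + Real.log (1 / δ') + 1) *
      (lnlnPlus (V + Real.log (1 / δ') + 1) + Real.log (1 / δ'))) ≤
      √((V + Real.log (1 / δ) + 1) *
      (lnlnPlus (V + Real.log (1 / δ) + 1) + Real.log (1 / δ))) := by
    -- `V` is an arbitrary real here; a negative radicand has square root `0`.
    rcases le_total 0 (V + Real.log (1 / δ') + 1) with hs | hs
    · refine Real.sqrt_le_sqrt (mul_le_mul (by linarith) ?_ (by linarith) (by linarith))
      linarith [lnlnPlus_mono (by linarith :
        V + Real.log (1 / δ') + 1 ≤ V + Real.log (1 / δ) + 1)]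
    · rw [Real.sqrt_eq_zero_of_nonpos (mul_nonpos_of_nonpos_of_nonneg hs (by linarith))]
      exact Real.sqrt_nonneg _
  exact mul_lt_mul_of_pos_left (by linarith) hD

theorem measurable_lnlnPlus : Measurable lnlnPlus := lnlnPlus_mono.measurable

theorem measurable_sampleList_sum {Ω : Type} [MeasurableSpace Ω] {X : ℕ → Ω → ℝ}
    (hX : ∀ i, Measurable (X i)) (n : ℕ) : Measurable fun ω => (sampleList X n ω).sum := by
  simp_rw [sampleList_sum]
  fun_prop

theorem measurable_empiricalVariance {Ω : Type} [MeasurableSpace Ω] {X : ℕ → Ω → ℝ}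
    (hX : ∀ i, Measurable (X i)) (n : ℕ) :
    Measurable fun ω => empiricalVariance (sampleList X n ω) := by
  have h1 := measurable_sampleList_sum hX n
  have h2 := measurable_sampleList_sum (X := fun i ω => X i ω ^ 2)
    (fun i => (hX i).pow_const 2) n
  have h3 : ∀ ω, empiricalVariance (sampleList X n ω) = (n : ℝ) / ((n : ℝ) - 1) *
      ((sampleList (fun i ω => X i ω ^ 2) n ω).sum -
        1 / (n : ℝ) * (sampleList X n ω).sum ^ 2) := by
    intro ω
    simp [empiricalVariance, sampleList, Function.comp_def]
  simp_rw [h3]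
  fun_prop

/-- A bound `δ'` on a probability for every `δ' > δ` gives the bound `δ`. -/
theorem measure_le_ofReal_of_forall_gt {Ω : Type*} [MeasurableSpace Ω] {μ : Measure Ω}
    [IsProbabilityMeasure μ] {A : Set Ω} {δ : ℝ} (hδ : 0 < δ)
    (h : ∀ δ', δ < δ' → δ' < 1 → ∃ G, MeasurableSet G ∧ A ⊆ Gᶜ ∧ ENNReal.ofReal (1 - δ') ≤ μ G) :
    μ A ≤ ENNReal.ofReal δ := by
  by_contra hlt
  push Not at hlt
  have hA1 : μ.real A ≤ 1 := measureReal_le_one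
  have hA : δ < μ.real A := by
    rw [Measure.real, ← ENNReal.ofReal_lt_iff_lt_toReal hδ.le (measure_ne_top _ _)]
    exact hlt
  obtain ⟨δ', h1, h2⟩ := exists_between hA
  obtain ⟨G, hG, hsub, hle⟩ := h δ' h1 (h2.trans_le hA1)
  have h3 : μ.real A ≤ 1 - μ.real G := by
    rw [← probReal_compl_eq_one_sub hG]
    exact measureReal_mono hsub
  have h4 : 1 - δ' ≤ μ.real G := (ENNReal.ofReal_le_iff_le_toReal (measure_ne_top _ _)).1 hle
  linarith

theorem IsVarConstant.measure_exists_le {D₁ : ℝ} (hD : IsVarConstant D₁) {Ω : Type}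
    [MeasurableSpace Ω] {μ : Measure Ω} [IsProbabilityMeasure μ] {X : ℕ → Ω → ℝ}
    (hX : IsCenteredIID μ X) {δ : ℝ} (hδ : 0 < δ) :
    μ {ω | ∃ n, CheckSignificantVar D₁ (sampleList X n ω) δ} ≤ ENNReal.ofReal δ := by
  refine measure_le_ofReal_of_forall_gt hδ fun δ' h1 h2 => ⟨_, ?_, ?_,
    hD _ μ X hX δ' (hδ.trans h1) h2⟩
  · rw [Set.ofPred_forall]
    refine MeasurableSet.iInter fun n => ?_
    rw [Set.ofPred_forall]
    refine MeasurableSet.iInter fun _ => ?_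
    have hV := measurable_empiricalVariance hX.measurable n
    have hl := measurable_lnlnPlus
    have hS := measurable_sampleList_sum hX.measurable n
    unfold varThreshold
    exact measurableSet_le (by fun_prop) (by fun_prop)
  · rintro ω ⟨n, hn1, hn2⟩ hω
    have hlen : (sampleList X n ω).length = n := by simp [sampleList]
    rw [hlen] at hn1
    have h3 := hω n ((log_one_div_lt hδ h1).le.trans hn1)
    have h4 := varThreshold_lt hD.pos hδ h1 h2 (empiricalVariance (sampleList X n ω))
    linarith [le_abs_self (sampleList X n ω).sum]

theorem IsMeanConstant.measure_exists_le {D₀ : ℝ} (hD : IsMeanConstant D₀) {Ω : Type}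
    [MeasurableSpace Ω] {μ : Measure Ω} [IsProbabilityMeasure μ] {X : ℕ → Ω → ℝ}
    (hX : IsCenteredIID μ X) {δ : ℝ} (hδ : 0 < δ) (hδ1 : δ < 1) :
    μ {ω | ∃ n, CheckSignificant D₀ (sampleList X n ω) δ} ≤ ENNReal.ofReal δ := by
  refine measure_le_ofReal_of_forall_gt hδ fun δ' h1 h2 => ⟨_, ?_, ?_,
    hD _ μ X hX δ' (hδ.trans h1) h2⟩
  · rw [Set.ofPred_forall]
    refine MeasurableSet.iInter fun n => ?_
    rw [Set.ofPred_forall]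
    refine MeasurableSet.iInter fun _ => ?_
    have hS := measurable_sampleList_sum hX.measurable n
    exact measurableSet_le (by fun_prop) (by fun_prop)
  · rintro ω ⟨n, hn⟩ hω
    have hlen : (sampleList X n ω).length = n := by simp [sampleList]
    rw [CheckSignificant, hlen] at hn
    have h4 := meanThreshold_lt hD.pos hδ h1 n
    -- Admissibility says nothing at `n = 0`, where the empty sum lies below a positive threshold.
    rcases Nat.eq_zero_or_pos n with rfl | hn0
    · have : 0 < meanThreshold D₀ 0 δ := by
        refine mul_pos hD.pos ?_
        have := log_one_div_pos hδ hδ1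
        positivity
      rw [sampleList_sum] at hn
      simp at hn
      linarith
    · linarith [le_abs_self (sampleList X n ω).sum, hω n hn0]

theorem List.sum_map_sub_const (X : List ℝ) (m : ℝ) :
    (X.map fun x => x - m).sum = X.sum - X.length * m := by
  induction X with
  | nil => simp
  | cons a X ih => simp [ih]; ring

theorem List.sum_map_sub_const_sq (X : List ℝ) (m : ℝ) :
    (X.map fun x => (x - m) ^ 2).sum =
      (X.map fun x => x ^ 2).sum - 2 * m * X.sum + X.length * m ^ 2 := by
  induction X with
  | nil => simp
  | cons a X ih => simp [ih]; ring

theorem empiricalVariance_map_sub_const (X : List ℝ) (m : ℝ) :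
    empiricalVariance (X.map fun x => x - m) = empiricalVariance X := by
  rcases Nat.eq_zero_or_pos X.length with h | h
  · simp [List.length_eq_zero_iff.1 h]
  · have : (X.length : ℝ) ≠ 0 := by positivity
    rw [empiricalVariance, empiricalVariance, List.length_map, List.map_map,
      List.sum_map_sub_const]
    simp only [Function.comp_def]
    rw [List.sum_map_sub_const_sq]
    field_simp
    ring

/-- Centering leaves the empirical variance, hence the threshold, unchanged and can only raise the
sum, as the mean is nonpositive. Centering values in `[-1, 1]` lands in `[-2, 2]`. -/
theorem IsVarConstant.measure_exists_checkSignificantVar_le {D₁ : ℝ} (hD : IsVarConstant D₁)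
    {S : Type} [MeasurableSpace S] {κ : Measure S} [IsProbabilityMeasure κ] {h : S → ℝ}
    (hm : Measurable h) (hb : ∀ s, |h s| ≤ 1) (h0 : ∫ s, h s ∂κ ≤ 0) {η : ℝ} (hη : 0 < η) :
    (Measure.infinitePi fun _ : ℕ => κ)
      {ω | ∃ n, CheckSignificantVar D₁ ((List.range n).map fun i => h (ω i)) η} ≤
      ENNReal.ofReal η := by
  set m := ∫ s, h s ∂κ with hmdef
  have hint : Integrable h κ := Integrable.of_bound hm.aestronglyMeasurable 1
    (Filter.Eventually.of_forall hb)
  have hm1 : |m| ≤ 1 := by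
    simpa using norm_integral_le_of_norm_le_const (μ := κ) (f := h) (C := 1)
      (Filter.Eventually.of_forall hb)
  have hX := isCenteredIID_infinitePi (κ := κ) (h := fun s => h s - m) (by fun_prop)
    (fun s => by
      have h1 := abs_le.1 (hb s)
      have h2 := abs_le.1 hm1
      exact ⟨by linarith, by linarith⟩)
    (by rw [integral_sub hint (integrable_const _)]; simp [hmdef]) Function.injective_id
  refine (measure_mono ?_).trans (hD.measure_exists_le hX hη)
  rintro ω ⟨n, h1, h2⟩
  have hs : sampleList (fun i (ω : ℕ → S) => h (ω (id i)) - m) n ω =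
      ((List.range n).map fun i => h (ω i)).map fun x => x - m := by
    simp [sampleList, Function.comp_def]
  refine ⟨n, ?_⟩
  rw [hs, CheckSignificantVar, empiricalVariance_map_sub_const, List.sum_map_sub_const,
    List.length_map]
  refine ⟨h1, h2.trans ?_⟩
  have := mul_nonpos_of_nonneg_of_nonpos
    (Nat.cast_nonneg (α := ℝ) ((List.range n).map fun i => h (ω i)).length) h0
  linarith

theorem IsMeanConstant.measure_exists_checkSignificant_le {D₀ : ℝ} (hD : IsMeanConstant D₀)
    {S : Type} [MeasurableSpace S] {κ : Measure S} [IsProbabilityMeasure κ] {h : S → ℝ}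
    (hm : Measurable h) (hb : ∀ s, |h s| ≤ 1) (h0 : ∫ s, h s ∂κ ≤ 0) {e : ℕ → ℕ}
    (he : Function.Injective e) {η : ℝ} (hη : 0 < η) (hη1 : η < 1) :
    (Measure.infinitePi fun _ : ℕ => κ)
      {ω | ∃ n, CheckSignificant D₀ ((List.range n).map fun i => h (ω (e i))) η} ≤
      ENNReal.ofReal η := by
  set m := ∫ s, h s ∂κ with hmdef
  have hint : Integrable h κ := Integrable.of_bound hm.aestronglyMeasurable 1
    (Filter.Eventually.of_forall hb)
  have hm1 : |m| ≤ 1 := by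
    simpa using norm_integral_le_of_norm_le_const (μ := κ) (f := h) (C := 1)
      (Filter.Eventually.of_forall hb)
  have hX := isCenteredIID_infinitePi (κ := κ) (h := fun s => h s - m) (by fun_prop)
    (fun s => by
      have h1 := abs_le.1 (hb s)
      have h2 := abs_le.1 hm1
      exact ⟨by linarith, by linarith⟩)
    (by rw [integral_sub hint (integrable_const _)]; simp [hmdef]) he
  refine (measure_mono ?_).trans (hD.measure_exists_le hX hη hη1)
  rintro ω ⟨n, h2⟩
  have hs : sampleList (fun i (ω : ℕ → S) => h (ω (e i)) - m) n ω =
      ((List.range n).map fun i => h (ω (e i))).map fun x => x - m := by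
    simp [sampleList, Function.comp_def]
  refine ⟨n, ?_⟩
  rw [hs, CheckSignificant, List.sum_map_sub_const, List.length_map]
  refine h2.trans ?_
  have := mul_nonpos_of_nonneg_of_nonpos
    (Nat.cast_nonneg (α := ℝ) ((List.range n).map fun i => h (ω (e i))).length) h0
  linarith

/-! ## The stream of labels -/

open Classical in
instance : Fintype Response :=
  ⟨{.zero, .one, .abstain}, fun r => by cases r <;> simp⟩

theorem Response.sum_univ {β : Type*} [AddCommMonoid β] (f : Response → β) :
    ∑ r, f r = f .zero + f .one + f .abstain := by
  classical
  change ∑ r ∈ {.zero, .one, .abstain}, f r = _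
  rw [Finset.sum_insert (by simp), Finset.sum_insert (by simp), Finset.sum_singleton, add_assoc]

/-- An event that depends on finitely many coordinates with finitely many values is measurable. -/
theorem measurableSet_of_forall_lt {S : Type*} [MeasurableSpace S] [MeasurableSingletonClass S]
    [Finite S] {Q : (ℕ → S) → Prop} (n : ℕ)
    (hQ : ∀ y y' : ℕ → S, (∀ i < n, y i = y' i) → Q y → Q y') : MeasurableSet {y | Q y} := by
  have h : {y | Q y} = (fun (y : ℕ → S) (i : Fin n) => y i) ⁻¹'
      {z | ∃ y, Q y ∧ ∀ i : Fin n, y i = z i} := by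
    ext y
    exact ⟨fun h => ⟨y, h, fun _ => rfl⟩, fun ⟨y', h, h'⟩ => hQ y' y (fun i hi => h' ⟨i, hi⟩) h⟩
  rw [h]
  exact (measurable_pi_lambda _ fun i => measurable_pi_apply _) (Set.toFinite _).measurableSet

/-- The response with abstentions from `r` and labels from `b`. -/
def relabel : Response → Bool → Response
  | .abstain, _ => .abstain
  | _, true => .one
  | _, false => .zero

/-- The value `±1` of a label. -/
def boolSign (b : Bool) : ℝ := if b then 1 else -1

theorem abs_boolSign (b : Bool) : |boolSign b| = 1 := by cases b <;> simp [boolSign]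

open Classical in
theorem labelValue?_relabel (r : Response) (b : Bool) :
    labelValue? (relabel r b) = if r = .abstain then none else some (boolSign b) := by
  cases r <;> cases b <;> simp [relabel, labelValue?, boolSign]

/-- The law of a label given that the labeler does not abstain. -/
def labelLaw (ρ : Measure Response) : Measure Bool :=
  (ρ {.one} / (ρ {.zero} + ρ {.one})) • Measure.dirac true +
    (ρ {.zero} / (ρ {.zero} + ρ {.one})) • Measure.dirac false

theorem isProbabilityMeasure_labelLaw {ρ : Measure Response} [IsProbabilityMeasure ρ]
    (h : ρ {.zero} + ρ {.one} ≠ 0) : IsProbabilityMeasure (labelLaw ρ) := by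
  constructor
  simp only [labelLaw, Measure.coe_add, Measure.coe_smul, Pi.add_apply, Pi.smul_apply,
    measure_univ, smul_eq_mul, mul_one]
  rw [← ENNReal.add_div, add_comm (ρ {.one}), ENNReal.div_self h (by finiteness)]

/-- One coordinate of the coupling: whether to answer is drawn from `ρ`, and the label is redrawn
from the conditional law. -/
theorem lintegral_labelLaw_relabel {ρ : Measure Response} [IsProbabilityMeasure ρ]
    (h : ρ {.zero} + ρ {.one} ≠ 0) (s : Set Response) :
    ∫⁻ r, labelLaw ρ {b | relabel r b ∈ s} ∂ρ = ρ s := by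
  classical
  have := isProbabilityMeasure_labelLaw h
  have hq : ρ {.zero} + ρ {.one} ≠ ⊤ := by finiteness
  have h1 : ∀ x : ENNReal, x / (ρ {.zero} + ρ {.one}) * ρ {.zero} +
      x / (ρ {.zero} + ρ {.one}) * ρ {.one} = x := fun x => by
    rw [← mul_add, ENNReal.div_mul_cancel h hq]
  have h2 := h1 (ρ {.zero})
  have h3 := h1 (ρ {.one})
  have h4 : ρ s = ∑ r, s.indicator 1 r * ρ {r} := by
    rw [← lintegral_fintype, lintegral_indicator_one .of_discrete]
  rw [lintegral_fintype, h4, Response.sum_univ, Response.sum_univ]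
  have h5 : labelLaw ρ {b | relabel .abstain b ∈ s} = s.indicator 1 .abstain := by
    by_cases ha : Response.abstain ∈ s
    · rw [show {b | relabel .abstain b ∈ s} = Set.univ from Set.eq_univ_of_forall fun _ => ha,
        measure_univ, Set.indicator_of_mem ha, Pi.one_apply]
    · rw [show {b | relabel .abstain b ∈ s} = ∅ from Set.eq_empty_of_forall_notMem fun _ => ha,
        measure_empty, Set.indicator_of_notMem ha]
  have h6 : ∀ r, r ≠ Response.abstain → labelLaw ρ {b | relabel r b ∈ s} =
      ρ {.one} / (ρ {.zero} + ρ {.one}) * s.indicator 1 .one +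
      ρ {.zero} / (ρ {.zero} + ρ {.one}) * s.indicator 1 .zero := by
    intro r hr
    rw [labelLaw, Measure.add_apply, Measure.smul_apply, Measure.smul_apply,
      Measure.dirac_apply, Measure.dirac_apply]
    cases r
    · by_cases h0 : Response.zero ∈ s <;> by_cases h1 : Response.one ∈ s <;>
        simp [relabel, h0, h1]
    · by_cases h0 : Response.zero ∈ s <;> by_cases h1 : Response.one ∈ s <;>
        simp [relabel, h0, h1]
    · exact absurd rfl hr
  rw [h5, h6 _ (by simp), h6 _ (by simp)]
  congr 1
  calc _ = s.indicator 1 .zero * (ρ {.zero} / (ρ {.zero} + ρ {.one}) * ρ {.zero} +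
        ρ {.zero} / (ρ {.zero} + ρ {.one}) * ρ {.one}) +
        s.indicator 1 .one * (ρ {.one} / (ρ {.zero} + ρ {.one}) * ρ {.zero} +
        ρ {.one} / (ρ {.zero} + ρ {.one}) * ρ {.one}) := by ring
    _ = _ := by rw [h2, h3]

/-- Drawing the labels separately from the abstentions does not change the law of the
responses. -/
theorem map_relabel_infinitePi {ρ : Measure Response} [IsProbabilityMeasure ρ]
    (h : ρ {.zero} + ρ {.one} ≠ 0) :
    ((Measure.infinitePi fun _ : ℕ => ρ).prod (Measure.infinitePi fun _ : ℕ => labelLaw ρ)).map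
      (fun p i => relabel (p.1 i) (p.2 i)) = Measure.infinitePi fun _ : ℕ => ρ := by
  have := isProbabilityMeasure_labelLaw h
  have hrm : Measurable fun p : Response × Bool => relabel p.1 p.2 := measurable_of_finite _
  have hmeas : Measurable fun (p : (ℕ → Response) × (ℕ → Bool)) i => relabel (p.1 i) (p.2 i) :=
    measurable_pi_lambda _ fun i => hrm.comp (f := fun p : (ℕ → Response) × (ℕ → Bool) =>
      (p.1 i, p.2 i)) (by fun_prop)
  refine Measure.eq_infinitePi _ fun s t ht => ?_
  have hst : MeasurableSet (Set.pi (s : Set ℕ) t) :=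
    MeasurableSet.pi s.countable_toSet fun i _ => ht i
  rw [Measure.map_apply hmeas hst, Measure.prod_apply (hmeas hst)]
  have h1 : ∀ a : ℕ → Response, (Measure.infinitePi fun _ : ℕ => labelLaw ρ)
      (Prod.mk a ⁻¹' ((fun (p : (ℕ → Response) × (ℕ → Bool)) i => relabel (p.1 i) (p.2 i)) ⁻¹'
        (Set.pi (s : Set ℕ) t))) = ∏ i ∈ s, labelLaw ρ {b | relabel (a i) b ∈ t i} := by
    intro a
    rw [← Measure.infinitePi_pi (fun _ : ℕ => labelLaw ρ) fun i _ => MeasurableSet.of_discrete]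
    congr 1
  simp_rw [h1]
  rw [lintegral_prod_eq_prod_lintegral_of_indepFun s
    (fun i (a : ℕ → Response) => labelLaw ρ {b | relabel (a i) b ∈ t i})
    (iIndepFun_infinitePi (P := fun _ : ℕ => ρ)
      (X := fun i r => labelLaw ρ {b | relabel r b ∈ t i}) fun i => measurable_of_finite _)
    fun i => (measurable_of_finite fun r => labelLaw ρ {b | relabel r b ∈ t i}).comp
      (measurable_pi_apply i)]
  refine Finset.prod_congr rfl fun i _ => ?_
  rw [← lintegral_labelLaw_relabel h (t i)]
  have h2 := lintegral_map (μ := Measure.infinitePi fun _ : ℕ => ρ)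
    (measurable_of_finite fun r => labelLaw ρ {b | relabel r b ∈ t i}) (measurable_pi_apply i)
  rw [Measure.infinitePi_map_eval] at h2
  exact h2.symm

theorem List.range_filter_eq_map_nth (p : ℕ → Prop) [DecidablePred p] (n : ℕ) :
    (List.range n).filter p = (List.range (Nat.count p n)).map (Nat.nth p) := by
  induction n with
  | zero => simp
  | succ n ih =>
    rw [List.range_succ, List.filter_append, ih, Nat.count_succ]
    by_cases h : p n
    · simp [h, List.range_succ, Nat.nth_count h]
    · simp [h]

/-- The list of labels, each multiplied by `s`. -/
def labelList (s : ℝ) (y : ℕ → Response) (n : ℕ) : List ℝ :=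
  (List.range n).filterMap fun i => (labelValue? (y i)).map (s * ·)

theorem labelList_congr {s : ℝ} {y y' : ℕ → Response} {n : ℕ} (h : ∀ i < n, y i = y' i) :
    labelList s y n = labelList s y' n :=
  List.filterMap_congr fun i hi => by rw [h i (List.mem_range.1 hi)]

theorem exists_labelList_relabel_eq (s : ℝ) (a : ℕ → Response) (N : ℕ) :
    ∃ e : ℕ → ℕ, Function.Injective e ∧ ∀ z : ℕ → Bool, ∀ n ≤ N, ∃ m,
      labelList s (fun i => relabel (a i) (z i)) n =
        (List.range m).map fun j => s * boolSign (z (e j)) := by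
  classical
  -- Adding all indices from `N` on keeps the set infinite, so that `Nat.nth p` is injective,
  -- without affecting lists up to the horizon `N`.
  let p : ℕ → Prop := fun i => a i ≠ .abstain ∨ N ≤ i
  have hinf : {i | p i}.Infinite :=
    (Set.Ici_infinite N).mono fun i hi => Or.inr hi
  refine ⟨Nat.nth p, Nat.nth_injective hinf, fun z n hn => ⟨Nat.count p n, ?_⟩⟩
  have h : labelList s (fun i => relabel (a i) (z i)) n =
      ((List.range n).filter p).map fun i => s * boolSign (z i) := by
    rw [labelList, ← List.filterMap_eq_map, List.filterMap_filter]
    refine List.filterMap_congr fun i hi => ?_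
    have hi' : ¬ N ≤ i := by have := List.mem_range.1 hi; omega
    rw [labelValue?_relabel]
    by_cases h : a i = .abstain <;> simp [p, h, hi']
  rw [h, List.range_filter_eq_map_nth, List.map_map]
  rfl

/-- The list has random length. Given the abstention pattern, its entries are i.i.d. labels read
along an injection, with mean of the sign of `hsign`; integrate over patterns and let the horizon
tend to infinity. -/
theorem IsMeanConstant.measure_exists_labelList_le {D₀ : ℝ} (hD : IsMeanConstant D₀)
    {ρ : Measure Response} [IsProbabilityMeasure ρ] (hρ : ρ {.zero} + ρ {.one} ≠ 0) {s : ℝ}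
    (hs : |s| = 1) (hsign : s * (ρ.real {.one} - ρ.real {.zero}) ≤ 0) {η : ℝ} (hη : 0 < η)
    (hη1 : η < 1) :
    (Measure.infinitePi fun _ : ℕ => ρ) {y | ∃ n, CheckSignificant D₀ (labelList s y n) η} ≤
      ENNReal.ofReal η := by
  have := isProbabilityMeasure_labelLaw hρ
  have hmeas : Measurable fun (p : (ℕ → Response) × (ℕ → Bool)) i => relabel (p.1 i) (p.2 i) :=
    measurable_pi_lambda _ fun i =>
      (measurable_of_finite fun p : Response × Bool => relabel p.1 p.2).comp
        (f := fun p : (ℕ → Response) × (ℕ → Bool) => (p.1 i, p.2 i)) (by fun_prop)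
  have hE : MeasurableSet {y | ∃ n, CheckSignificant D₀ (labelList s y n) η} := by
    rw [Set.ofPred_exists]
    exact MeasurableSet.iUnion fun n => measurableSet_of_forall_lt n fun y y' h hy => by
      rwa [← labelList_congr h]
  rw [← map_relabel_infinitePi hρ, Measure.map_apply hmeas hE, Measure.prod_apply (hmeas hE)]
  refine (lintegral_mono fun a => ?_).trans (lintegral_const (ENNReal.ofReal η)).le |>.trans
    (by simp)
  have hU : (Prod.mk a ⁻¹' ((fun (p : (ℕ → Response) × (ℕ → Bool)) i => relabel (p.1 i) (p.2 i)) ⁻¹'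
      {y | ∃ n, CheckSignificant D₀ (labelList s y n) η})) =
      ⋃ N, {z : ℕ → Bool | ∃ n ≤ N, CheckSignificant D₀
        (labelList s (fun i => relabel (a i) (z i)) n) η} := by
    ext z
    simp only [Set.mem_preimage, Set.mem_ofPred_eq, Set.mem_iUnion]
    exact ⟨fun ⟨n, h⟩ => ⟨n, n, le_rfl, h⟩, fun ⟨_, n, _, h⟩ => ⟨n, h⟩⟩
  have hmono : Monotone fun N => {z : ℕ → Bool | ∃ n ≤ N, CheckSignificant D₀
      (labelList s (fun i => relabel (a i) (z i)) n) η} :=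
    fun N N' h z ⟨n, hn, h'⟩ => ⟨n, hn.trans h, h'⟩
  rw [hU, hmono.measure_iUnion]
  refine iSup_le fun N => ?_
  obtain ⟨e, he, hlist⟩ := exists_labelList_relabel_eq s a N
  refine (measure_mono ?_).trans (hD.measure_exists_checkSignificant_le (κ := labelLaw ρ)
    (h := fun b => s * boolSign b) (measurable_of_finite _)
    (fun b => by rw [abs_mul, hs, abs_boolSign, one_mul]) ?_ he hη hη1)
  · rintro z ⟨n, hn, h⟩
    obtain ⟨m, hm⟩ := hlist z n hn
    exact ⟨m, hm ▸ h⟩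
  · have h0 : ρ {.zero} + ρ {.one} ≠ ⊤ := by finiteness
    have hint : ∫ b, s * boolSign b ∂labelLaw ρ =
        s * (ρ.real {.one} - ρ.real {.zero}) / (ρ {.zero} + ρ {.one}).toReal := by
      rw [integral_const_mul, labelLaw, integral_add_measure, integral_smul_measure,
        integral_smul_measure, integral_dirac, integral_dirac]
      · simp [boolSign, ENNReal.toReal_div, Measure.real]
        ring
      · exact Integrable.of_finite.smul_measure (ENNReal.div_ne_top (by finiteness) hρ)
      · exact Integrable.of_finite.smul_measure (ENNReal.div_ne_top (by finiteness) hρ)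
    rw [hint]
    exact div_nonpos_of_nonpos_of_nonneg hsign ENNReal.toReal_nonneg

/-! ## One pass of the outer loop -/

open Classical in
instance : Fintype Quartile :=
  ⟨{.u, .m, .v}, fun w => by cases w <;> simp⟩

instance : Countable Quartile := Finite.to_countable

/-- The law of the responses of one iteration. -/
abbrev iterationLaw (ρ : Quartile → Measure Response) : Measure (Quartile → Response) :=
  Measure.infinitePi ρ

/-- The law of the responses of a whole pass. -/
abbrev roundLaw (ρ : Quartile → Measure Response) : Measure (ℕ → Quartile → Response) :=
  Measure.infinitePi fun _ => iterationLaw ρ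

/-- The difference of the abstention indicators at `w` and at the midpoint. -/
def answeredDiff (w : Quartile) (s : Quartile → Response) : ℝ :=
  answeredValue (s w) - answeredValue (s .m)

theorem diffA_eq_map (ans : ℕ → Quartile → Response) (w : Quartile) (n : ℕ) :
    diffA ans w n = (List.range n).map fun i => answeredDiff w (ans i) := by
  rw [diffA, arrayA, arrayA, List.zipWith_map, List.zipWith_self]
  rfl

theorem answeredValue_mem (r : Response) : answeredValue r = 0 ∨ answeredValue r = 1 := by
  cases r <;> simp [answeredValue]

theorem abs_answeredDiff_le (w : Quartile) (s : Quartile → Response) :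
    |answeredDiff w s| ≤ 1 := by
  rw [answeredDiff]
  rcases answeredValue_mem (s w) with h | h <;> rcases answeredValue_mem (s .m) with h' | h' <;>
    simp [h, h']

theorem answeredDiff_sq_le (w : Quartile) (s : Quartile → Response) :
    answeredDiff w s ^ 2 ≤ answeredValue (s w) + answeredValue (s .m) := by
  rw [answeredDiff]
  rcases answeredValue_mem (s w) with h | h <;> rcases answeredValue_mem (s .m) with h' | h' <;>
    simp [h, h']

theorem measurable_answeredDiff (w : Quartile) : Measurable (answeredDiff w) :=
  ((measurable_of_finite answeredValue).comp (measurable_pi_apply w)).sub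
    ((measurable_of_finite answeredValue).comp (measurable_pi_apply Quartile.m))

theorem Response.sum_measureReal_singleton (ρ : Measure Response) [IsProbabilityMeasure ρ] :
    ρ.real {.zero} + ρ.real {.one} + ρ.real {.abstain} = 1 := by
  have h := integral_fintype (μ := ρ) (f := fun _ => (1 : ℝ)) Integrable.of_finite
  rw [Response.sum_univ] at h
  simpa using h.symm

theorem integral_answeredValue (ρ : Measure Response) [IsProbabilityMeasure ρ] :
    ∫ r, answeredValue r ∂ρ = 1 - ρ.real {.abstain} := by
  rw [integral_fintype Integrable.of_finite, Response.sum_univ,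
    ← Response.sum_measureReal_singleton ρ]
  simp [answeredValue]

section

variable {ρ : Quartile → Measure Response} [∀ w, IsProbabilityMeasure (ρ w)]

theorem integral_answeredValue_iterationLaw (w : Quartile) :
    ∫ s, answeredValue (s w) ∂iterationLaw ρ = 1 - (ρ w).real {.abstain} := by
  rw [← integral_answeredValue]
  have h := integral_map (μ := iterationLaw ρ) (measurable_pi_apply w).aemeasurable
    (measurable_of_finite answeredValue).aestronglyMeasurable
  rw [Measure.infinitePi_map_eval] at h
  exact h.symm

theorem integral_answeredDiff (w : Quartile) :
    ∫ s, answeredDiff w s ∂iterationLaw ρ = (ρ .m).real {.abstain} - (ρ w).real {.abstain} := by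
  simp only [answeredDiff]
  rw [integral_sub Integrable.of_finite Integrable.of_finite,
    integral_answeredValue_iterationLaw, integral_answeredValue_iterationLaw]
  ring

theorem integral_answeredDiff_sq_le (w : Quartile) :
    ∫ s, answeredDiff w s ^ 2 ∂iterationLaw ρ ≤
      (1 - (ρ w).real {.abstain}) + (1 - (ρ .m).real {.abstain}) := by
  rw [← integral_answeredValue_iterationLaw, ← integral_answeredValue_iterationLaw,
    ← integral_add Integrable.of_finite Integrable.of_finite]
  exact integral_mono Integrable.of_finite Integrable.of_finite (answeredDiff_sq_le w)

theorem IsVarConstant.roundLaw_diffA_le {D₁ : ℝ} (hD : IsVarConstant D₁) {w : Quartile}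
    (h : (ρ .m).real {.abstain} ≤ (ρ w).real {.abstain}) {η : ℝ} (hη : 0 < η) :
    roundLaw ρ {ans | ∃ n, CheckSignificantVar D₁ (diffA ans w n) η} ≤ ENNReal.ofReal η := by
  simp_rw [diffA_eq_map]
  refine hD.measure_exists_checkSignificantVar_le (measurable_answeredDiff w)
    (abs_answeredDiff_le w) ?_ hη
  rw [integral_answeredDiff]
  linarith

theorem map_roundLaw (w : Quartile) :
    (roundLaw ρ).map (fun ans i => ans i w) = Measure.infinitePi fun _ : ℕ => ρ w := by
  refine (Measure.infinitePi_map_pi (fun _ : ℕ => iterationLaw ρ)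
    (f := fun _ (s : Quartile → Response) => s w) fun _ => measurable_pi_apply w).trans ?_
  simp_rw [Measure.infinitePi_map_eval]

theorem IsMeanConstant.roundLaw_labelList_le {D₀ : ℝ} (hD : IsMeanConstant D₀) {w : Quartile}
    (hρ : (ρ w) {.zero} + (ρ w) {.one} ≠ 0) {s : ℝ} (hs : |s| = 1)
    (hsign : s * ((ρ w).real {.one} - (ρ w).real {.zero}) ≤ 0) {η : ℝ} (hη : 0 < η)
    (hη1 : η < 1) :
    roundLaw ρ {ans | ∃ n, CheckSignificant D₀ (labelList s (fun i => ans i w) n) η} ≤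
      ENNReal.ofReal η := by
  refine le_trans ?_ (hD.measure_exists_labelList_le hρ hs hsign hη hη1)
  rw [← map_roundLaw w]
  exact Measure.le_map_apply
    (measurable_pi_lambda _ fun i =>
      (measurable_pi_apply w).comp (measurable_pi_apply i)).aemeasurable _

/-! ### Power of the variance test. -/

/-- The deterministic part of the detection bound: with a sum of order `cx` and a variance of
order `x`, the test succeeds. -/
theorem varThreshold_le {D₁ c k x V η : ℝ} (hD : 0 < D₁) (hc : 0 < c)
    (hk : (52 * D₁ + 8) / c = k) (hk1 : 1 ≤ k) (hΛ : 1 ≤ Real.log (1 / η))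
    (hx : k ^ 4 * Real.log (1 / η) ≤ x) (hV : V ≤ 10 * x) :
    varThreshold D₁ V η ≤ c / 4 * x := by
  set Λ := Real.log (1 / η)
  have hk0 : 0 < k := by linarith
  have hk4 : k ^ 4 ≤ x := le_trans (le_mul_of_one_le_right (by positivity) hΛ) hx
  have hx1 : 1 ≤ x := (one_le_pow₀ hk1).trans hk4
  have hk24 : k ^ 2 ≤ k ^ 4 := pow_le_pow_right₀ hk1 (by norm_num)
  have hk14 : k ≤ k ^ 4 := le_self_pow₀ hk1 (by norm_num)
  have hΛx : k ^ 2 * Λ ≤ x := (mul_le_mul_of_nonneg_right hk24 (by linarith)).trans hx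
  have hΛk : k * Λ ≤ x := (mul_le_mul_of_nonneg_right hk14 (by linarith)).trans hx
  have hΛx1 : Λ ≤ x := le_trans (le_mul_of_one_le_left (by linarith) hk1) hΛk
  -- The fourth power of `k` is needed here: the iterated logarithm is bounded crudely by order
  -- `√x`.
  have hsx : k ^ 2 * √x ≤ x := by
    have h1 : k ^ 2 ≤ √x := Real.le_sqrt_of_sq_le (by rw [← pow_mul]; exact hk4)
    calc k ^ 2 * √x ≤ √x * √x := mul_le_mul_of_nonneg_right h1 (Real.sqrt_nonneg _)
      _ = x := Real.mul_self_sqrt (by linarith)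
  have hT : V + Λ + 1 ≤ 12 * x := by linarith
  have hl : lnlnPlus (V + Λ + 1) ≤ 1 + 7 * √x := by
    refine (lnlnPlus_mono hT).trans (lnlnPlus_le_one_add_sqrt.trans ?_)
    have : √(12 * x) ≤ 3.5 * √x := by
      refine Real.sqrt_le_iff.2 ⟨by positivity, ?_⟩
      rw [mul_pow, Real.sq_sqrt (by linarith)]
      linarith
    linarith
  have hl0 := one_le_lnlnPlus (V + Λ + 1)
  have hs : √((V + Λ + 1) * (lnlnPlus (V + Λ + 1) + Λ)) ≤ 11 * x / k := by
    refine Real.sqrt_le_iff.2 ⟨by positivity, ?_⟩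
    have h1 : (V + Λ + 1) * (lnlnPlus (V + Λ + 1) + Λ) ≤ 12 * x * (1 + 7 * √x + Λ) :=
      mul_le_mul hT (by linarith) (by linarith) (by linarith)
    refine h1.trans ?_
    rw [div_pow, le_div_iff₀ (by positivity)]
    have h2 : (1 + 7 * √x + Λ) * k ^ 2 ≤ 9 * x := by linarith
    nlinarith
  have hΛd : 1 + Λ ≤ 2 * x / k := by
    rw [le_div_iff₀ hk0]; nlinarith
  -- `13 * D₁ / k ≤ c / 4` is the reason for `52 = 4 * 13` in `k`.
  calc varThreshold D₁ V η ≤ D₁ * (2 * x / k + 11 * x / k) :=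
        mul_le_mul_of_nonneg_left (by linarith) hD.le
    _ = 13 * D₁ / k * x := by ring
    _ ≤ c / 4 * x := by
        refine mul_le_mul_of_nonneg_right ?_ (by linarith)
        rw [div_le_iff₀ hk0, ← hk]
        field_simp
        linarith

theorem roundLaw_ville {h : (Quartile → Response) → ℝ} (hm : Measurable h)
    (h1 : ∫⁻ s, ENNReal.ofReal (Real.exp (h s)) ∂iterationLaw ρ ≤ 1) (a : ℝ) :
    roundLaw ρ {ans | ∃ n, a ≤ ∑ i ∈ Finset.range n, h (ans i)} ≤
      ENNReal.ofReal (Real.exp (-a)) := by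
  refine measure_exists_le_sum_le_exp_neg (fun i => hm.comp (measurable_pi_apply i))
    (iIndepFun_infinitePi (P := fun _ : ℕ => iterationLaw ρ) (X := fun _ => h) fun _ => hm)
    (fun i => ?_) a
  have h2 := lintegral_map (μ := roundLaw ρ) (f := fun s => ENNReal.ofReal (Real.exp (h s)))
    (by fun_prop) (measurable_pi_apply i)
  rw [Measure.infinitePi_map_eval] at h2
  exact h2 ▸ h1

/-- A pass is detected as finished after order `ln(1/η) / a` iterations, where `a` is the
response rate at `w`. -/
theorem roundLaw_not_checkSignificantVar_le {D₁ : ℝ} (hD : 0 < D₁) {w : Quartile} {a c k η : ℝ}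
    {N : ℕ} (hc : 0 < c) (hc1 : c < 1) (hk : (52 * D₁ + 8) / c = k) (hη : 0 < η)
    (hΛ : 1 ≤ Real.log (1 / η)) (ha : 0 ≤ a) (ha1 : a ≤ 1)
    (hN : k ^ 4 * Real.log (1 / η) ≤ a * N)
    (hw : 1 - (ρ w).real {.abstain} = a) (hm : 1 - (ρ .m).real {.abstain} ≤ (1 - c) * a) :
    roundLaw ρ {ans | ¬ CheckSignificantVar D₁ (diffA ans w N) η} ≤
      ENNReal.ofReal (2 * η) := by
  set Λ := Real.log (1 / η) with hΛd
  have hexp : Real.exp (-Λ) = η := by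
    rw [hΛd, one_div, Real.log_inv, neg_neg, Real.exp_log hη]
  have hk8 : 8 / c ≤ k := by rw [← hk]; gcongr; linarith
  have hk8' : 8 ≤ k := le_trans (by rw [le_div_iff₀ hc]; linarith) hk8
  have hk1 : 1 ≤ k := by linarith
  set l := c / 8 with hl
  have hlpos : 0 < l := by positivity
  -- The lower tail of the sum: the drift `c * a` compensates the tilt `-l`, as `(1 - l c a) exp (l
  -- c a) ≤ 1`. Below, `Z'` controls the sum of squares.
  let Z : (Quartile → Response) → ℝ := fun s =>
    -l * answeredDiff w s - (-l) ^ 2 * answeredDiff w s ^ 2 + l * (c * a)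
  let Z' : (Quartile → Response) → ℝ := fun s => answeredDiff w s ^ 2 - 4 * a
  have hmd := measurable_answeredDiff w
  have hE : ∫⁻ s, ENNReal.ofReal (Real.exp (Z s)) ∂iterationLaw ρ ≤ 1 := by
    simp only [Z]
    simp_rw [Real.exp_add, ENNReal.ofReal_mul (Real.exp_pos _).le]
    rw [lintegral_mul_const _ (by fun_prop)]
    refine (mul_le_mul_left (lintegral_exp_sub_sq_le hmd (abs_answeredDiff_le w) ?_) _).trans ?_
    · rw [abs_neg, abs_of_pos hlpos]
      linarith
    · rw [integral_answeredDiff, ← ENNReal.ofReal_mul' (Real.exp_pos _).le]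
      refine ENNReal.ofReal_le_one.2 ?_
      have h1 : c * a ≤ (ρ .m).real {.abstain} - (ρ w).real {.abstain} := by linarith
      have h2 : 1 + -l * ((ρ .m).real {.abstain} - (ρ w).real {.abstain}) ≤
          Real.exp (-(l * (c * a))) := by
        have := Real.add_one_le_exp (-(l * (c * a)))
        nlinarith
      calc _ ≤ Real.exp (-(l * (c * a))) * Real.exp (l * (c * a)) :=
            mul_le_mul_of_nonneg_right h2 (Real.exp_pos _).le
        _ = 1 := by rw [← Real.exp_add]; simp
  have hE' : ∫⁻ s, ENNReal.ofReal (Real.exp (Z' s)) ∂iterationLaw ρ ≤ 1 := by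
    simp only [Z', sub_eq_add_neg]
    simp_rw [Real.exp_add, ENNReal.ofReal_mul (Real.exp_pos _).le]
    rw [lintegral_mul_const _ (by fun_prop)]
    have h1 : ∫⁻ s, ENNReal.ofReal (Real.exp (answeredDiff w s ^ 2)) ∂iterationLaw ρ ≤
        ENNReal.ofReal (Real.exp (4 * a)) := by
      rw [← ofReal_integral_eq_lintegral_ofReal Integrable.of_finite
        (Filter.Eventually.of_forall fun _ => (Real.exp_pos _).le)]
      refine ENNReal.ofReal_le_ofReal ?_
      calc ∫ s, Real.exp (answeredDiff w s ^ 2) ∂iterationLaw ρ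
          ≤ ∫ s, (1 + 2 * answeredDiff w s ^ 2) ∂iterationLaw ρ := by
            refine integral_mono Integrable.of_finite Integrable.of_finite fun s => ?_
            have h2 : answeredDiff w s ^ 2 ≤ 1 := by
              rw [sq_le_one_iff_abs_le_one]
              exact abs_answeredDiff_le w s
            have h3 := Real.abs_exp_sub_one_sub_id_le (x := answeredDiff w s ^ 2)
              (by rwa [abs_of_nonneg (sq_nonneg _)])
            have h4 := (abs_le.1 h3).2
            have h5 := sq_nonneg (answeredDiff w s)
            simp only
            nlinarith
        _ = 1 + 2 * ∫ s, answeredDiff w s ^ 2 ∂iterationLaw ρ := by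
            rw [integral_add Integrable.of_finite Integrable.of_finite, integral_const_mul]
            simp
        _ ≤ 1 + 4 * a := by
            have := integral_answeredDiff_sq_le (ρ := ρ) w
            nlinarith
        _ ≤ Real.exp (4 * a) := by linarith [Real.add_one_le_exp (4 * a)]
    refine (mul_le_mul_left h1 _).trans ?_
    rw [← ENNReal.ofReal_mul (Real.exp_pos _).le, ← Real.exp_add]
    simp
  have hV1 := roundLaw_ville (by fun_prop) hE Λ
  have hV2 := roundLaw_ville (by fun_prop) hE' Λ
  rw [hexp] at hV1 hV2
  have hsub : {ans | ¬ CheckSignificantVar D₁ (diffA ans w N) η} ⊆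
      {ans | ∃ n, Λ ≤ ∑ i ∈ Finset.range n, Z (ans i)} ∪
      {ans | ∃ n, Λ ≤ ∑ i ∈ Finset.range n, Z' (ans i)} := by
    intro ans hans
    by_contra hcon
    simp only [Set.mem_union, Set.mem_ofPred_eq, not_or, not_exists, not_le] at hcon
    refine hans ?_
    have h1 := hcon.1 N
    have h2 := hcon.2 N
    have hlist := diffA_eq_map ans w N
    have hS : (diffA ans w N).sum = ∑ i ∈ Finset.range N, answeredDiff w (ans i) := by
      rw [hlist]
      exact sampleList_sum (fun i (ans : ℕ → Quartile → Response) => answeredDiff w (ans i)) N ans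
    have hW : ((diffA ans w N).map fun x => x ^ 2).sum =
        ∑ i ∈ Finset.range N, answeredDiff w (ans i) ^ 2 := by
      rw [hlist, List.map_map]
      exact sampleList_sum
        (fun i (ans : ℕ → Quartile → Response) => answeredDiff w (ans i) ^ 2) N ans
    have hlen : (diffA ans w N).length = N := by rw [hlist]; simp
    simp only [Z, Z'] at h1 h2
    rw [Finset.sum_add_distrib, Finset.sum_sub_distrib, ← Finset.mul_sum, ← Finset.mul_sum,
      Finset.sum_const, Finset.card_range, nsmul_eq_mul, ← hS, ← hW] at h1
    rw [Finset.sum_sub_distrib, Finset.sum_const, Finset.card_range, nsmul_eq_mul, ← hW] at h2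
    have hW0 : 0 ≤ ((diffA ans w N).map fun x => x ^ 2).sum := by
      rw [hW]; exact Finset.sum_nonneg fun _ _ => sq_nonneg _
    set S := (diffA ans w N).sum with hSd
    set W := ((diffA ans w N).map fun x => x ^ 2).sum with hWd
    set x := a * N with hxd
    have hk2 : 8 * k ≤ k ^ 4 := by nlinarith [pow_le_pow_right₀ hk1 (by norm_num : 2 ≤ 4)]
    have hk64 : 64 ≤ k ^ 4 := by linarith
    have hx64 : 64 * Λ ≤ x := (mul_le_mul_of_nonneg_right hk64 (by linarith)).trans hN
    have hxN : x ≤ N := mul_le_of_le_one_left (by positivity) ha1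
    have hN2 : (2 : ℝ) ≤ N := by linarith
    have hW5 : W ≤ 5 * x := by rw [hxd] at hx64 ⊢; nlinarith
    -- Of the drift `c * x`, the squares cost at most `5/8` since `l = c / 8`, and the confidence
    -- term costs `1/8` since `c * k ≥ 8`, the role of the `8` in `k`.
    have hS4 : c / 4 * x ≤ S := by
      have h3 : 64 * Λ ≤ c ^ 2 * x := by
        have h4 : 64 ≤ c ^ 2 * k ^ 4 := by
          have h5 : 8 ≤ c * k := by rw [div_le_iff₀ hc] at hk8; linarith
          have h6 : 64 ≤ (c * k) ^ 2 := by nlinarith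
          calc (64 : ℝ) ≤ (c * k) ^ 2 := h6
            _ ≤ c ^ 2 * k ^ 4 := by
              rw [mul_pow]
              exact mul_le_mul_of_nonneg_left (pow_le_pow_right₀ hk1 (by norm_num)) (sq_nonneg c)
        calc 64 * Λ ≤ c ^ 2 * k ^ 4 * Λ := mul_le_mul_of_nonneg_right h4 (by linarith)
          _ = c ^ 2 * (k ^ 4 * Λ) := by ring
          _ ≤ c ^ 2 * x := mul_le_mul_of_nonneg_left hN (sq_nonneg c)
      have h7 : l * (c * x - l * W - S) < Λ := by
        rw [hxd]
        linarith
      have h8 : l * (c * x - l * (5 * x) - S) < l * (c / 8 * x) := by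
        have h9 : l * (l * W) ≤ l * (l * (5 * x)) := by gcongr
        rw [hl] at h7 h9 ⊢
        nlinarith
      have h10 := lt_of_mul_lt_mul_left h8 hlpos.le
      have h11 : l * (5 * x) ≤ 5 / 8 * (c * x) := by rw [hl]; linarith
      linarith
    have hV : empiricalVariance (diffA ans w N) ≤ 10 * x := by
      rw [empiricalVariance, hlen, ← hSd, ← hWd]
      have h3 : (N : ℝ) / (N - 1) ≤ 2 := by
        rw [div_le_iff₀ (by linarith)]; linarith
      have h4 : W - 1 / N * S ^ 2 ≤ W := by
        have : 0 ≤ 1 / (N : ℝ) * S ^ 2 := by positivity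
        linarith
      have h5 : (0 : ℝ) ≤ N / (N - 1) := div_nonneg (by linarith) (by linarith)
      calc (N : ℝ) / (N - 1) * (W - 1 / N * S ^ 2) ≤ N / (N - 1) * W := by gcongr
        _ ≤ 2 * W := by gcongr
        _ ≤ 10 * x := by linarith
    refine ⟨?_, ?_⟩
    · rw [hlen]
      linarith
    · exact (varThreshold_le hD hc hk hk1 hΛ hN hV).trans hS4
  refine (measure_mono hsub).trans ((measure_union_le _ _).trans ((add_le_add hV1 hV2).trans ?_))
  rw [← ENNReal.ofReal_add hη.le hη.le, two_mul]

end

/-- A pass from the interval `I` makes at most `3N` queries and keeps `θ` in the new interval. -/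
def RoundSucceeds (D₀ D₁ η : ℝ) (I : ℝ × ℝ) (θ : ℝ) (N : ℕ) (ans : ℕ → Quartile → Response) :
    Prop :=
  ∃ (J : ℝ × ℝ) (m : ℕ), searchRound D₀ D₁ η I ans = some (J, m) ∧ m ≤ 3 * N ∧
    θ ∈ Set.Icc J.1 J.2

theorem labelList_one (ans : ℕ → Quartile → Response) (w : Quartile) (n : ℕ) :
    labelList 1 (fun i => ans i w) n = arrayB ans w n := by
  simp [labelList, arrayB]

theorem labelList_neg_one (ans : ℕ → Quartile → Response) (w : Quartile) (n : ℕ) :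
    labelList (-1) (fun i => ans i w) n = (arrayB ans w n).map fun b => -b := by
  simp [labelList, arrayB, List.map_filterMap]

/-- The cases in which a test of iteration `n` holds. -/
theorem iterationTest_eq_some {D₀ D₁ η : ℝ} {I J : ℝ × ℝ} {ans : ℕ → Quartile → Response} {n : ℕ}
    (h : iterationTest D₀ D₁ η I ans n = some J) :
    (J = (quartile I .u, I.2) ∧ (CheckSignificantVar D₁ (diffA ans .u n) η ∨
      CheckSignificant D₀ (labelList (-1) (fun i => ans i .u) n) η)) ∨
    (J = (I.1, quartile I .v) ∧ (CheckSignificantVar D₁ (diffA ans .v n) η ∨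
      CheckSignificant D₀ (labelList 1 (fun i => ans i .v) n) η)) := by
  rw [labelList_one, labelList_neg_one]
  unfold iterationTest at h
  split_ifs at h with h1 h2 h3 h4
  · exact Or.inl ⟨(Option.some.inj h).symm, Or.inl h1⟩
  · exact Or.inr ⟨(Option.some.inj h).symm, Or.inl h2⟩
  · exact Or.inl ⟨(Option.some.inj h).symm, Or.inr h3⟩
  · exact Or.inr ⟨(Option.some.inj h).symm, Or.inr h4⟩

/-- Termination relies on the abstention tests alone; the label tests can only end a pass sooner. -/
theorem isSome_iterationTest {D₀ D₁ η : ℝ} {I : ℝ × ℝ} {ans : ℕ → Quartile → Response} {n : ℕ}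
    {w : Quartile} (hw : w ≠ .m) (h : CheckSignificantVar D₁ (diffA ans w n) η) :
    (iterationTest D₀ D₁ η I ans n).isSome := by
  unfold iterationTest
  cases w
  · simp [h]
  · exact absurd rfl hw
  · split_ifs <;> simp

theorem searchRound_eq_some {D₀ D₁ η : ℝ} {I : ℝ × ℝ} {ans : ℕ → Quartile → Response}
    {r : (ℝ × ℝ) × ℕ} (h : searchRound D₀ D₁ η I ans = some r) :
    ∃ n, iterationTest D₀ D₁ η I ans n = some r.1 ∧ r.2 = 3 * n := by
  classical
  unfold searchRound at h
  split_ifs at h with h1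
  obtain ⟨J, hJ, rfl⟩ := Option.map_eq_some_iff.1 h
  exact ⟨_, hJ, rfl⟩

/-- The pass stops by iteration `N`, and `θ` can be lost only if a test at a quartile on the wrong
side of `θ` ever fires. -/
theorem roundSucceeds_of_tests {D₀ D₁ η θ : ℝ} {I : ℝ × ℝ} {N : ℕ}
    {ans : ℕ → Quartile → Response} (hθ : θ ∈ Set.Icc I.1 I.2) (hN : 1 ≤ N)
    (hsome : (iterationTest D₀ D₁ η I ans N).isSome)
    (hu : θ < quartile I .u → ¬ ((∃ n, CheckSignificantVar D₁ (diffA ans .u n) η) ∨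
      ∃ n, CheckSignificant D₀ (labelList (-1) (fun i => ans i .u) n) η))
    (hv : quartile I .v < θ → ¬ ((∃ n, CheckSignificantVar D₁ (diffA ans .v n) η) ∨
      ∃ n, CheckSignificant D₀ (labelList 1 (fun i => ans i .v) n) η)) :
    RoundSucceeds D₀ D₁ η I θ N ans := by
  classical
  have hex : ∃ n : ℕ, 1 ≤ n ∧ (iterationTest D₀ D₁ η I ans n).isSome := ⟨N, hN, hsome⟩
  obtain ⟨J, hJ⟩ := Option.isSome_iff_exists.1 (Nat.find_spec hex).2
  refine ⟨J, 3 * Nat.find hex, ?_, by have := Nat.find_min' hex ⟨hN, hsome⟩; omega, ?_⟩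
  · unfold searchRound
    rw [dif_pos hex]
    convert congrArg (Option.map fun J => (J, 3 * Nat.find hex)) hJ using 1
    rfl
  · rcases iterationTest_eq_some hJ with ⟨rfl, h⟩ | ⟨rfl, h⟩
    · refine ⟨not_lt.1 fun hlt => hu hlt ?_, hθ.2⟩
      exact h.imp (fun h => ⟨_, h⟩) fun h => ⟨_, h⟩
    · refine ⟨hθ.1, not_lt.1 fun hlt => hv hlt ?_⟩
      exact h.imp (fun h => ⟨_, h⟩) fun h => ⟨_, h⟩

/-! ### From the labeler's conditions to the failure probability of a pass. -/

section

variable {d : ℕ} {g : (Fin (d - 1) → ℝ) → ℝ} {f : ℝ → ℝ} {c : ℝ} {P : Labeler d}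

theorem ShapeCondition.measureReal_abstain (h : ShapeCondition g f c P)
    {x : Fin (d - 1) → ℝ} (hx : x ∈ unitCube d) {y : ℝ} (hy : y ∈ Set.Icc (0 : ℝ) 1) :
    (P (x, y)).toMeasure.real {.abstain} = 1 - f |y - g x| := by
  rw [← h.abstention x hx y hy, Measure.real, PMF.toMeasure_apply_singleton _ _ .of_discrete]

/-- Makes the conditional label law well defined. On the boundary itself `f 0` may vanish. -/
theorem ShapeCondition.zero_add_one_ne_zero (h : ShapeCondition g f c P)
    {x : Fin (d - 1) → ℝ} (hx : x ∈ unitCube d) {y : ℝ} (hy : y ∈ Set.Icc (0 : ℝ) 1)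
    (hg : g x ∈ Set.Icc (0 : ℝ) 1) (hne : y ≠ g x) :
    (P (x, y)).toMeasure {.zero} + (P (x, y)).toMeasure {.one} ≠ 0 := by
  intro h0
  have h1 := Response.sum_measureReal_singleton (P (x, y)).toMeasure
  rw [h.measureReal_abstain hx hy, Measure.real, Measure.real,
    ← ENNReal.toReal_add (by finiteness) (by finiteness), h0] at h1
  have h2 := h.pos |y - g x| (abs_pos.2 (sub_ne_zero.2 hne))
    (abs_le.2 ⟨by linarith [hy.1, hg.2], by linarith [hy.2, hg.1]⟩)
  simp at h1
  linarith

/-- The noise condition: the true label is at least as likely as the other one. -/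
theorem MonotoneCondition.measure_le (h : MonotoneCondition g P) {x : Fin (d - 1) → ℝ}
    (hx : x ∈ unitCube d) {y : ℝ} (hy : y ∈ Set.Icc (0 : ℝ) 1) {r r' : Response}
    (hr : r = trueLabel g (x, y)) (hr' : r' ≠ .abstain) (hrr' : r ≠ r') :
    (P (x, y)).toMeasure.real {r'} ≤ (P (x, y)).toMeasure.real {r} := by
  set ρ := (P (x, y)).toMeasure with hρ
  have hra : r ≠ .abstain := by
    rw [hr, trueLabel]; split_ifs <;> simp
  have hset : {s | s ≠ Response.abstain} = ({r, r'} : Set Response) := by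
    clear hr hρ
    ext s
    cases s <;> cases r <;> cases r' <;> simp at hra hr' hrr' ⊢
  have hset' : {s | s ≠ Response.abstain} ∩ {s | s ≠ r} = ({r'} : Set Response) := by
    clear hr hρ hset
    ext s
    cases s <;> cases r <;> cases r' <;> simp at hra hr' hrr' ⊢
  have hn := h.noise x hx y hy
  rw [← hr, ← hρ, cond_apply .of_discrete, hset', hset] at hn
  have hpair : ρ {r, r'} = ρ {r} + ρ {r'} := by
    rw [Set.insert_eq, measure_union (by simpa using hrr') .of_discrete]
  have hfin : ρ {r} + ρ {r'} ≠ ⊤ := by finiteness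
  rcases eq_or_ne (ρ {r} + ρ {r'}) 0 with h0 | h0
  · simp only [add_eq_zero] at h0
    simp [Measure.real, h0.1, h0.2]
  · rw [hpair, mul_comm, ← div_eq_mul_inv, ENNReal.div_le_iff h0 hfin] at hn
    have h1 : ρ.real {r'} ≤ 1 / 2 * (ρ.real {r} + ρ.real {r'}) := by
      have := ENNReal.toReal_mono (by finiteness) hn
      rw [ENNReal.toReal_mul, ENNReal.toReal_add (by finiteness) (by finiteness)] at this
      simpa [Measure.real] using this
    linarith

theorem quartile_mem_Icc {I : ℝ × ℝ} (h0 : 0 ≤ I.1) (h1 : I.2 ≤ 1) (hI : I.1 ≤ I.2)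
    (w : Quartile) : quartile I w ∈ Set.Icc (0 : ℝ) 1 := by
  cases w <;> simp only [quartile] <;> constructor <;> linarith

/-- The law of the responses of a pass in the interval `I` on the line through `x`. -/
abbrev labelerRoundLaw (P : Labeler d) (x : Fin (d - 1) → ℝ) (I : ℝ × ℝ) :
    Measure (ℕ → Quartile → Response) :=
  roundLaw fun w => (P (x, quartile I w)).toMeasure

/-- The outer quartile across the midpoint from `θ` detects within `N` iterations, up to `2η`. If `θ
< U`, then `U` is nearer to `θ` than the midpoint and its label leans to `1`, so both tests at `U`
have nonpositive mean: another `2η`. The case `V < θ` is symmetric, and between the two every cut is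
correct. -/
theorem labelerRoundLaw_not_roundSucceeds_le {D₀ D₁ : ℝ} (hD₀ : IsMeanConstant D₀)
    (hD₁ : IsVarConstant D₁) (hc : 0 < c) (hc1 : c < 1) (hP : MonotoneCondition g P)
    (hS : ShapeCondition g f c P) {x : Fin (d - 1) → ℝ} (hx : x ∈ unitCube d)
    (hg : g x ∈ Set.Icc (0 : ℝ) 1) {I : ℝ × ℝ} (h0 : 0 ≤ I.1) (h1 : I.2 ≤ 1) (hI : I.1 < I.2)
    (hθ : g x ∈ Set.Icc I.1 I.2) {k η : ℝ} (hk : (52 * D₁ + 8) / c = k) (hη : 0 < η)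
    (hΛ : 1 ≤ Real.log (1 / η)) {N : ℕ}
    (hN : k ^ 4 * Real.log (1 / η) ≤ f ((I.2 - I.1) / 4) * N) :
    labelerRoundLaw P x I {ans | ¬ RoundSucceeds D₀ D₁ η I (g x) N ans} ≤
      ENNReal.ofReal (4 * η) := by
  set θ := g x
  have hη1 : η < 1 := by
    by_contra hge
    have : Real.log (1 / η) ≤ 0 := by
      rw [one_div, Real.log_inv]
      linarith [Real.log_nonneg (not_lt.1 hge)]
    linarith
  have hq := quartile_mem_Icc h0 h1 hI.le
  have habs : ∀ w, |quartile I w - θ| ∈ Set.Icc (0 : ℝ) 1 := fun w =>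
    ⟨abs_nonneg _, abs_le.2 ⟨by linarith [(hq w).1, hg.2], by linarith [(hq w).2, hg.1]⟩⟩
  have habst : ∀ w, (P (x, quartile I w)).toMeasure.real {.abstain} =
      1 - f |quartile I w - θ| := fun w => hS.measureReal_abstain hx (hq w)
  have hqu : quartile I .u = (3 * I.1 + I.2) / 4 := rfl
  have hqm : quartile I .m = (I.1 + I.2) / 2 := rfl
  have hqv : quartile I .v = (I.1 + 3 * I.2) / 4 := rfl
  have hk0 : 0 < k := by
    rw [← hk]
    have := hD₁.pos
    positivity
  have hfl : 0 ≤ f ((I.2 - I.1) / 4) := (hS.mapsTo ⟨by linarith, by linarith⟩).1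
  have hN1 : 1 ≤ N := by
    rcases Nat.eq_zero_or_pos N with rfl | h
    · have : 0 < k ^ 4 * Real.log (1 / η) := by positivity
      rw [Nat.cast_zero, mul_zero] at hN
      linarith
    · exact h
  have hslow : ∀ w, w ≠ .m → (I.2 - I.1) / 4 ≤ |quartile I w - θ| →
      |quartile I .m - θ| ≤ 2 / 3 * |quartile I w - θ| →
      labelerRoundLaw P x I {ans | ¬ (iterationTest D₀ D₁ η I ans N).isSome} ≤
        ENNReal.ofReal (2 * η) := by
    intro w hw h2 h3
    have ha := hS.mapsTo (habs w)
    have hpos : 0 < |quartile I w - θ| := by linarith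
    have hfpos := hS.pos _ hpos (habs w).2
    have hsub : {ans | ¬ (iterationTest D₀ D₁ η I ans N).isSome} ⊆
        {ans | ¬ CheckSignificantVar D₁ (diffA ans w N) η} :=
      fun ans hans hcon => hans (isSome_iterationTest hw hcon)
    refine (measure_mono hsub).trans
      (roundLaw_not_checkSignificantVar_le hD₁.pos (w := w) (N := N) hc hc1 hk hη hΛ ha.1 ha.2
        (hN.trans ?_) (by rw [habst]; ring) ?_)
    · gcongr
      exact hS.monotone ⟨by linarith, by linarith⟩ (habs w) h2
    · have := hS.ratio _ hpos (habs w).2 _ (abs_nonneg _) h3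
      rw [habst, sub_sub_cancel]
      rwa [div_le_iff₀ hfpos] at this
  have hslow' : labelerRoundLaw P x I {ans | ¬ (iterationTest D₀ D₁ η I ans N).isSome} ≤
      ENNReal.ofReal (2 * η) := by
    -- The distance ratio is largest when `θ` is an endpoint: half the length against three
    -- quarters, exactly the `2/3` of the shape condition.
    rcases le_total θ (quartile I .m) with h | h
    · refine hslow .v (by simp) ?_ ?_
      · rw [abs_of_nonneg (by linarith)]; linarith
      · rw [abs_of_nonneg (by linarith), abs_of_nonneg (by linarith)]
        linarith [hθ.1]
    · refine hslow .u (by simp) ?_ ?_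
      · rw [abs_of_nonpos (by linarith)]; linarith
      · rw [abs_of_nonpos (by linarith), abs_of_nonpos (by linarith)]
        linarith [hθ.2]
  have hwrong : ∀ w (s : ℝ), |s| = 1 → quartile I w ≠ θ →
      |quartile I w - θ| ≤ |quartile I .m - θ| →
      s * ((P (x, quartile I w)).toMeasure.real {.one} -
        (P (x, quartile I w)).toMeasure.real {.zero}) ≤ 0 →
      labelerRoundLaw P x I {ans | (∃ n, CheckSignificantVar D₁ (diffA ans w n) η) ∨
        ∃ n, CheckSignificant D₀ (labelList s (fun i => ans i w) n) η} ≤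
        ENNReal.ofReal (2 * η) := by
    intro w s hs hne hle hsign
    refine (measure_union_le _ _).trans ((add_le_add (hD₁.roundLaw_diffA_le ?_ hη)
      (hD₀.roundLaw_labelList_le (hS.zero_add_one_ne_zero hx (hq w) hg hne) hs hsign hη
        hη1)).trans ?_)
    · rw [habst, habst]
      linarith [hS.monotone (habs w) (habs .m) hle]
    · rw [← ENNReal.ofReal_add hη.le hη.le, two_mul]
  have hfour : ENNReal.ofReal (2 * η) + ENNReal.ofReal (2 * η) = ENNReal.ofReal (4 * η) := by
    rw [← ENNReal.ofReal_add (by positivity) (by positivity)]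
    ring_nf
  rcases lt_or_ge θ (quartile I .u) with hu | hu
  · have htrue : Response.one = trueLabel g (x, quartile I .u) := (if_pos hu).symm
    have hB := hwrong .u (-1) (by simp) hu.ne'
      (by rw [abs_of_nonneg (by linarith), abs_of_nonneg (by linarith)]; linarith)
      (by linarith [hP.measure_le hx (hq .u) htrue (r' := .zero) (by simp) (by simp)])
    refine le_trans (measure_mono ?_) ((measure_union_le _ _).trans
      ((add_le_add hslow' hB).trans hfour.le))
    intro ans hans
    by_contra hcon
    rw [Set.mem_union, not_or] at hcon
    exact hans (roundSucceeds_of_tests hθ hN1 (not_not.1 hcon.1) (fun _ => hcon.2)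
      fun h => by linarith)
  rcases lt_or_ge (quartile I .v) θ with hv | hv
  · have htrue : Response.zero = trueLabel g (x, quartile I .v) := (if_neg hv.not_gt).symm
    have hB := hwrong .v 1 (by simp) hv.ne
      (by rw [abs_of_nonpos (by linarith), abs_of_nonpos (by linarith)]; linarith)
      (by linarith [hP.measure_le hx (hq .v) htrue (r' := .one) (by simp) (by simp)])
    refine le_trans (measure_mono ?_) ((measure_union_le _ _).trans
      ((add_le_add hslow' hB).trans hfour.le))
    intro ans hans
    by_contra hcon
    rw [Set.mem_union, not_or] at hcon
    exact hans (roundSucceeds_of_tests hθ hN1 (not_not.1 hcon.1) (fun h => by linarith)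
      fun _ => hcon.2)
  · refine le_trans (measure_mono ?_) (hslow'.trans
      (ENNReal.ofReal_le_ofReal (by linarith)))
    intro ans hans hcon
    exact hans (roundSucceeds_of_tests hθ hN1 hcon (fun h => absurd h hu.not_gt)
      fun h => absurd h hv.not_gt)

end

/-! ## The run on one line -/

theorem iterationTest_congr {D₀ D₁ η : ℝ} {I : ℝ × ℝ} {ans ans' : ℕ → Quartile → Response} {n : ℕ}
    (h : ∀ i < n, ans i = ans' i) :
    iterationTest D₀ D₁ η I ans n = iterationTest D₀ D₁ η I ans' n := by
  have hA : ∀ w, arrayA ans w n = arrayA ans' w n := fun w =>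
    List.map_congr_left fun i hi => by rw [h i (List.mem_range.1 hi)]
  have hB : ∀ w, arrayB ans w n = arrayB ans' w n := fun w =>
    List.filterMap_congr fun i hi => by rw [h i (List.mem_range.1 hi)]
  have hD : ∀ w, diffA ans w n = diffA ans' w n := fun w => by rw [diffA, hA, hA, ← diffA]
  unfold iterationTest
  rw [hD, hD, hB, hB]

/-- For fixed `n` the condition involves only the first `n` iterations, which yields measurability.
-/
theorem searchRound_eq_some_iff {D₀ D₁ η : ℝ} {I : ℝ × ℝ} {ans : ℕ → Quartile → Response}
    {r : (ℝ × ℝ) × ℕ} : searchRound D₀ D₁ η I ans = some r ↔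
      ∃ n, (1 ≤ n ∧ iterationTest D₀ D₁ η I ans n = some r.1 ∧ r.2 = 3 * n) ∧
        ∀ n' < n, 1 ≤ n' → iterationTest D₀ D₁ η I ans n' = none := by
  classical
  unfold searchRound
  constructor
  · intro h
    split_ifs at h with h1
    obtain ⟨J, hJ, rfl⟩ := Option.map_eq_some_iff.1 h
    refine ⟨_, ⟨(Nat.find_spec h1).1, hJ, rfl⟩, fun n' hn' hn1 => ?_⟩
    have := Nat.find_min h1 hn'
    simpa [hn1] using this
  · rintro ⟨n, ⟨h1, h2, h3⟩, h4⟩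
    have hex : ∃ n : ℕ, 1 ≤ n ∧ (iterationTest D₀ D₁ η I ans n).isSome :=
      ⟨n, h1, by rw [h2]; rfl⟩
    have hfind : Nat.find hex = n := by
      rw [Nat.find_eq_iff]
      exact ⟨⟨h1, by rw [h2]; rfl⟩, fun n' hn' ⟨h5, h6⟩ => by simp [h4 n' hn' h5] at h6⟩
    rw [dif_pos hex]
    refine Option.map_eq_some_iff.2 ⟨r.1, ?_, ?_⟩
    · rw [← h2]
      congr 1
    · exact Prod.ext rfl (by rw [h3, ← hfind])

theorem measurableSet_searchRound (D₀ D₁ η : ℝ) (I : ℝ × ℝ) (r : (ℝ × ℝ) × ℕ) :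
    MeasurableSet {ans | searchRound D₀ D₁ η I ans = some r} := by
  simp_rw [searchRound_eq_some_iff]
  rw [Set.ofPred_exists]
  refine MeasurableSet.iUnion fun n => measurableSet_of_forall_lt n fun y y' h hy => ?_
  rw [← iterationTest_congr h]
  exact ⟨hy.1, fun n' hn' h1 => by
    rw [← iterationTest_congr fun i hi => h i (hi.trans hn')]
    exact hy.2 n' hn' h1⟩

open Classical in
/-- The intervals that can occur after `k` passes. -/
def reachable : ℕ → Finset (ℝ × ℝ)
  | 0 => {(0, 1)}
  | k + 1 => (reachable k).image (fun I => (quartile I .u, I.2)) ∪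
      (reachable k).image (fun I => (I.1, quartile I .v))

theorem reachable_bounds {k : ℕ} {I : ℝ × ℝ} (h : I ∈ reachable k) :
    0 ≤ I.1 ∧ I.2 ≤ 1 ∧ I.2 - I.1 = (3 / 4) ^ k := by
  induction k generalizing I with
  | zero =>
    obtain rfl : I = (0, 1) := by simpa [reachable] using h
    simp
  | succ k ih =>
    have hp : (0 : ℝ) < (3 / 4) ^ k := by positivity
    simp only [reachable, Finset.mem_union, Finset.mem_image] at h
    rcases h with ⟨J, hJ, rfl⟩ | ⟨J, hJ, rfl⟩ <;> obtain ⟨h0, h1, h2⟩ := ih hJ <;>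
      simp only [quartile, pow_succ] <;> refine ⟨by linarith, by linarith, by linarith⟩

section

variable {D₀ D₁ ε δ : ℝ} {resp : ℕ → ℕ → Quartile → ℝ → Response}

theorem thresholdSearch_succ_eq_some_iff {k : ℕ} {J : ℝ × ℝ} {m : ℕ} :
    thresholdSearch D₀ D₁ ε δ resp (k + 1) = some (J, m) ↔
      ∃ I m', thresholdSearch D₀ D₁ ε δ resp k = some (I, m') ∧
        ∃ m'', searchRound D₀ D₁ (δ / (4 * numRounds ε)) I
          (fun i w => resp k i w (quartile I w)) = some (J, m'') ∧ m' + m'' = m := by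
  rw [thresholdSearch, Option.bind_eq_some_iff]
  constructor
  · rintro ⟨⟨I, m'⟩, h1, h2⟩
    obtain ⟨⟨J', m''⟩, h3, h4⟩ := Option.map_eq_some_iff.1 h2
    cases h4
    exact ⟨I, m', h1, m'', h3, rfl⟩
  · rintro ⟨I, m', h1, m'', h2, rfl⟩
    exact ⟨(I, m'), h1, Option.map_eq_some_iff.2 ⟨(J, m''), h2, rfl⟩⟩

theorem mem_reachable_of_thresholdSearch {k : ℕ} {I : ℝ × ℝ} {m : ℕ}
    (h : thresholdSearch D₀ D₁ ε δ resp k = some (I, m)) : I ∈ reachable k := by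
  induction k generalizing I m with
  | zero =>
    simp only [thresholdSearch, Option.some.injEq, Prod.mk.injEq] at h
    simp [reachable, ← h.1]
  | succ k ih =>
    obtain ⟨I', m', h1, m'', h2, _⟩ := thresholdSearch_succ_eq_some_iff.1 h
    obtain ⟨n, hn, _⟩ := searchRound_eq_some h2
    simp only [reachable, Finset.mem_union, Finset.mem_image]
    exact (iterationTest_eq_some hn).imp (fun h => ⟨I', ih h1, h.1.symm⟩)
      fun h => ⟨I', ih h1, h.1.symm⟩

end

section

variable {d M : ℕ}

/-- The σ-algebra of the responses of the passes in `T`. -/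
abbrev roundAlgebra (d M : ℕ) (T : Set ℕ) : MeasurableSpace (QueryIndex d M → Response) :=
  ⨆ q ∈ {q : QueryIndex d M | q.round ∈ T}, MeasurableSpace.comap (fun ω => ω q) inferInstance

theorem roundAlgebra_le (T : Set ℕ) : roundAlgebra d M T ≤ MeasurableSpace.pi :=
  iSup₂_le fun q _ => (measurable_pi_apply q).comap_le

theorem roundAlgebra_mono {T T' : Set ℕ} (h : T ⊆ T') :
    roundAlgebra d M T ≤ roundAlgebra d M T' :=
  biSup_mono fun _ hq => h hq

theorem indep_roundAlgebra (P : Labeler d) {T T' : Set ℕ} (h : Disjoint T T') :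
    Indep (roundAlgebra d M T) (roundAlgebra d M T') (responseLaw P M) :=
  indep_iSup_of_disjoint (fun q => (measurable_pi_apply q).comap_le)
    (iIndepFun_infinitePi (P := fun q : QueryIndex d M => (P (gridPoint q.run, q.height)).toMeasure)
      (X := fun _ r => r) fun _ => measurable_id)
    (Set.disjoint_left.2 fun _ hq hq' => Set.disjoint_left.1 h hq hq')

/-- The responses at the quartiles of `I` in pass `k` of the run `l`. -/
def roundResponses (l : GridIndex d M) (k : ℕ) (I : ℝ × ℝ) (ω : QueryIndex d M → Response) :
    ℕ → Quartile → Response :=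
  fun i w => ω ⟨l, k, i, w, quartile I w⟩

theorem measurable_roundResponses (l : GridIndex d M) (k : ℕ) (I : ℝ × ℝ) :
    Measurable[roundAlgebra d M {k}] (roundResponses l k I) :=
  @measurable_pi_lambda _ _ _ (roundAlgebra d M {k}) _ _ fun i =>
    @measurable_pi_lambda _ _ _ (roundAlgebra d M {k}) _ _ fun w =>
      Measurable.of_comap_le (le_iSup₂_of_le (f := fun (q : QueryIndex d M)
        (_ : q ∈ {q : QueryIndex d M | q.round ∈ ({k} : Set ℕ)}) =>
          MeasurableSpace.comap (fun ω : QueryIndex d M → Response => ω q) inferInstance)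
        ⟨l, k, i, w, quartile I w⟩ rfl le_rfl)

/-- For a deterministic interval, distinct iterations and quartiles read distinct coordinates of the
product space. -/
theorem map_roundResponses (P : Labeler d) (l : GridIndex d M) (k : ℕ) (I : ℝ × ℝ) :
    (responseLaw P M).map (roundResponses l k I) = labelerRoundLaw P (gridPoint l) I := by
  let e : ℕ × Quartile → QueryIndex d M := fun p => ⟨l, k, p.1, p.2, quartile I p.2⟩
  have he : Function.Injective e := fun p p' h => by
    simp only [e, QueryIndex.mk.injEq] at h
    exact Prod.ext h.2.2.1 h.2.2.2.1
  have h1 := Measure.map_infinitePi_infinitePi_of_inj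
    (P := fun q : QueryIndex d M => (P (gridPoint q.run, q.height)).toMeasure) he
  have h2 := Measure.infinitePi_map_curry
    fun (_ : ℕ) w => (P (gridPoint l, quartile I w)).toMeasure
  rw [labelerRoundLaw, roundLaw, iterationLaw, ← h2]
  change _ = Measure.map _ (Measure.infinitePi fun p =>
    (P (gridPoint (e p).run, (e p).height)).toMeasure)
  rw [← h1, Measure.map_map (by fun_prop) (by fun_prop)]
  rfl

/-- The state of the run `l` after `k` passes. -/
def runState (D₀ D₁ ε δ : ℝ) (l : GridIndex d M) (k : ℕ) (ω : QueryIndex d M → Response) :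
    Option ((ℝ × ℝ) × ℕ) :=
  thresholdSearch D₀ D₁ ε δ (fun k i w y => ω ⟨l, k, i, w, y⟩) k

theorem measurableSet_runState (D₀ D₁ ε δ : ℝ) (l : GridIndex d M) (k : ℕ) (I : ℝ × ℝ) (m : ℕ) :
    MeasurableSet[roundAlgebra d M {j | j < k}] {ω | runState D₀ D₁ ε δ l k ω = some (I, m)} := by
  induction k generalizing I m with
  | zero =>
    exact @MeasurableSet.const _ (roundAlgebra d M {j | j < 0})
      (some (((0 : ℝ), (1 : ℝ)), 0) = some (I, m))
  | succ k ih =>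
    have hset : {ω | runState D₀ D₁ ε δ l (k + 1) ω = some (I, m)} =
        ⋃ I' ∈ reachable k, ⋃ m', ⋃ m'', {ω | runState D₀ D₁ ε δ l k ω = some (I', m')} ∩
          (roundResponses l k I' ⁻¹' {ans | searchRound D₀ D₁ (δ / (4 * numRounds ε)) I' ans =
            some (I, m'')} ∩ {_ω | m' + m'' = m}) := by
      ext ω
      simp only [Set.mem_iUnion, Set.mem_inter_iff, Set.mem_preimage, Set.mem_ofPred_eq,
        exists_prop]
      constructor
      · intro h
        obtain ⟨I', m', h1, m'', h2, h3⟩ := thresholdSearch_succ_eq_some_iff.1 h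
        exact ⟨I', mem_reachable_of_thresholdSearch h1, m', m'', h1, h2, h3⟩
      · rintro ⟨I', _, m', m'', h1, h2, h3⟩
        exact thresholdSearch_succ_eq_some_iff.2 ⟨I', m', h1, m'', h2, h3⟩
    rw [hset]
    refine Finset.measurableSet_biUnion _ fun I' _ => MeasurableSet.iUnion fun m' =>
      MeasurableSet.iUnion fun m'' => MeasurableSet.inter ?_ (MeasurableSet.inter ?_
        (MeasurableSet.const _))
    · exact roundAlgebra_mono (fun j (hj : j < k) => Nat.lt_succ_of_lt hj) _ (ih I' m')
    · exact roundAlgebra_mono (by simp) _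
        (measurable_roundResponses l k I' (measurableSet_searchRound _ _ _ _ _))

/-- After `k` passes the run is still correct and has made at most `3Nk` queries. -/
def RunSucceeds (D₀ D₁ ε δ : ℝ) (l : GridIndex d M) (θ : ℝ) (N k : ℕ)
    (ω : QueryIndex d M → Response) : Prop :=
  ∃ (I : ℝ × ℝ) (m : ℕ), runState D₀ D₁ ε δ l k ω = some (I, m) ∧ m ≤ 3 * N * k ∧
    θ ∈ Set.Icc I.1 I.2

/-- Split by the interval `I` reached after `k` passes. That event depends on earlier passes only,
so it is independent of the responses of pass `k` at the quartiles of `I`; the weights of the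
disjoint events sum to at most one. -/
theorem measure_not_runSucceeds_succ_le (P : Labeler d) {D₀ D₁ ε δ θ : ℝ} {l : GridIndex d M}
    {N k : ℕ} {b : ENNReal}
    (hb : ∀ I ∈ reachable k, θ ∈ Set.Icc I.1 I.2 → labelerRoundLaw P (gridPoint l) I
      {ans | ¬ RoundSucceeds D₀ D₁ (δ / (4 * numRounds ε)) I θ N ans} ≤ b) :
    responseLaw P M {ω | ¬ RunSucceeds D₀ D₁ ε δ l θ N (k + 1) ω} ≤
      responseLaw P M {ω | ¬ RunSucceeds D₀ D₁ ε δ l θ N k ω} + b := by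
  classical
  set μ := responseLaw P M with hμ
  have : IsProbabilityMeasure μ := by rw [hμ, responseLaw]; infer_instance
  let A : ℝ × ℝ → Set (QueryIndex d M → Response) := fun I =>
    ⋃ m, {ω | runState D₀ D₁ ε δ l k ω = some (I, m)}
  -- A measurable hull has the same measure, so the failure event need not be shown measurable.
  let bad : ℝ × ℝ → Set (ℕ → Quartile → Response) := fun I =>
    toMeasurable (labelerRoundLaw P (gridPoint l) I)
      {ans | ¬ RoundSucceeds D₀ D₁ (δ / (4 * numRounds ε)) I θ N ans}
  let T := (reachable k).filter fun I => θ ∈ Set.Icc I.1 I.2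
  have hA : ∀ I, MeasurableSet[roundAlgebra d M {j | j < k}] (A I) := fun I =>
    MeasurableSet.iUnion fun m => measurableSet_runState D₀ D₁ ε δ l k I m
  have hsub : {ω | ¬ RunSucceeds D₀ D₁ ε δ l θ N (k + 1) ω} ⊆
      {ω | ¬ RunSucceeds D₀ D₁ ε δ l θ N k ω} ∪
        ⋃ I ∈ T, A I ∩ roundResponses l k I ⁻¹' bad I := by
    intro ω hω
    by_contra hcon
    rw [Set.mem_union, not_or] at hcon
    obtain ⟨I, m, h1, h2, h3⟩ := not_not.1 hcon.1
    have hI : I ∈ T := Finset.mem_filter.2 ⟨mem_reachable_of_thresholdSearch h1, h3⟩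
    have h4 : roundResponses l k I ω ∉ bad I := fun h => hcon.2 (Set.mem_iUnion₂.2
      ⟨I, hI, Set.mem_iUnion.2 ⟨m, h1⟩, h⟩)
    have h5 := fun h => h4 (subset_toMeasurable _ _ h)
    obtain ⟨J, m'', h6, h7, h8⟩ := not_not.1 h5
    refine hω ⟨J, m + m'', thresholdSearch_succ_eq_some_iff.2 ⟨I, m, h1, m'', h6, rfl⟩, ?_, h8⟩
    rw [mul_add, mul_one]
    exact add_le_add h2 h7
  refine (measure_mono hsub).trans ((measure_union_le _ _).trans ?_)
  gcongr
  have hterm : ∀ I ∈ T, μ (A I ∩ roundResponses l k I ⁻¹' bad I) ≤ μ (A I) * b := by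
    intro I hI
    have hbad : MeasurableSet (bad I) := measurableSet_toMeasurable _ _
    have hind := Indep_iff _ _ μ |>.1 (indep_roundAlgebra (M := M) P
      (T := {j | j < k}) (T' := {k}) (by simp)) _ _ (hA I)
      (measurable_roundResponses l k I hbad)
    rw [hind]
    gcongr
    have hm : Measurable (roundResponses l k I) :=
      (measurable_roundResponses l k I).mono (roundAlgebra_le _) le_rfl
    rw [← Measure.map_apply hm hbad, map_roundResponses, measure_toMeasurable]
    exact hb I (Finset.mem_filter.1 hI).1 (Finset.mem_filter.1 hI).2
  calc μ (⋃ I ∈ T, A I ∩ roundResponses l k I ⁻¹' bad I)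
      ≤ ∑ I ∈ T, μ (A I ∩ roundResponses l k I ⁻¹' bad I) := measure_biUnion_finset_le _ _
    _ ≤ ∑ I ∈ T, μ (A I) * b := Finset.sum_le_sum hterm
    _ = (∑ I ∈ T, μ (A I)) * b := (Finset.sum_mul _ _ _).symm
    _ = μ (⋃ I ∈ T, A I) * b := by
        rw [measure_biUnion_finset _ fun I _ => roundAlgebra_le _ _ (hA I)]
        intro I _ I' _ hne
        refine Set.disjoint_left.2 fun ω h h' => hne ?_
        obtain ⟨m, hm⟩ := Set.mem_iUnion.1 h
        obtain ⟨m', hm'⟩ := Set.mem_iUnion.1 h'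
        have := Option.some.inj (Eq.trans (Eq.symm hm) hm')
        exact congrArg Prod.fst this
    _ ≤ 1 * b := by gcongr; exact prob_le_one
    _ = b := one_mul b

theorem measure_not_runSucceeds_le (P : Labeler d) {D₀ D₁ ε δ θ : ℝ} {l : GridIndex d M}
    {N K : ℕ} {b : ENNReal} (hθ : θ ∈ Set.Icc (0 : ℝ) 1)
    (hb : ∀ k < K, ∀ I ∈ reachable k, θ ∈ Set.Icc I.1 I.2 → labelerRoundLaw P (gridPoint l) I
      {ans | ¬ RoundSucceeds D₀ D₁ (δ / (4 * numRounds ε)) I θ N ans} ≤ b) :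
    responseLaw P M {ω | ¬ RunSucceeds D₀ D₁ ε δ l θ N K ω} ≤ K * b := by
  induction K with
  | zero =>
    have : {ω | ¬ RunSucceeds D₀ D₁ ε δ l θ N 0 ω} = ∅ :=
      Set.eq_empty_of_forall_notMem fun ω hω => hω ⟨(0, 1), 0, rfl, by simp, hθ⟩
    simp [this]
  | succ K ih =>
    refine (measure_not_runSucceeds_succ_le P (hb K (Nat.lt_succ_self K))).trans ?_
    push_cast
    rw [add_mul, one_mul]
    gcongr
    exact ih fun k hk => hb k (hk.trans (Nat.lt_succ_self K))

end

/-! ## The query complexity -/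

theorem numRounds_le {ε : ℝ} (hε : 0 < ε) (hε1 : ε < 1) :
    (numRounds ε : ℝ) ≤ 4 * (1 + Real.log (1 / ε)) := by
  have hE := log_one_div_pos hε hε1
  have h43 : 1 / 4 ≤ Real.log (4 / 3) := by
    have := Real.one_sub_inv_le_log_of_pos (by norm_num : (0 : ℝ) < 4 / 3)
    norm_num at this ⊢
    linarith
  have h1 : Real.logb (4 / 3) (1 / (2 * ε)) ≤ 4 * Real.log (1 / ε) := by
    rw [Real.logb, div_le_iff₀ (by linarith)]
    have h2 : Real.log (1 / (2 * ε)) ≤ Real.log (1 / ε) :=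
      Real.log_le_log (by positivity) (one_div_le_one_div_of_le hε (by linarith))
    nlinarith
  rcases le_total (Real.logb (4 / 3) (1 / (2 * ε))) 0 with h | h
  · rw [numRounds, Nat.ceil_eq_zero.2 h]
    push_cast
    linarith
  · have := Nat.ceil_lt_add_one h
    rw [numRounds]
    linarith

/-- The interval has length `(3/4)^k` when pass `k` starts, so its quarter exceeds `ε / 2`; this is
the source of `f (ε / 2)`. -/
theorem lt_pow_of_lt_numRounds {ε : ℝ} (hε : 0 < ε) {k : ℕ} (hk : k < numRounds ε) :
    2 * ε < (3 / 4) ^ k := by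
  have h1 := Nat.lt_ceil.1 hk
  rw [Real.lt_logb_iff_rpow_lt (by norm_num) (by positivity), Real.rpow_natCast,
    lt_div_iff₀ (by positivity)] at h1
  have h2 : ((3 : ℝ) / 4) ^ k * (4 / 3) ^ k = 1 := by
    rw [← mul_pow]; norm_num
  have h3 : (0 : ℝ) < (4 / 3) ^ k := by positivity
  nlinarith

theorem gridPoint_mem_unitCube {d M : ℕ} (l : GridIndex d M) : gridPoint l ∈ unitCube d := by
  refine ⟨fun i => by simp only [gridPoint, Pi.zero_apply]; positivity, fun i => ?_⟩
  simp only [gridPoint, Pi.one_apply]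
  exact div_le_one_of_le₀ (by exact_mod_cast (l i).2.le) (Nat.cast_nonneg _)

/-- The confidence level of a single test is at most polynomially small. -/
theorem log_one_div_level_le {B ε δ : ℝ} {d γ M : ℕ} (hB : 0 < B) (hd : 2 ≤ d) (hγ : 1 ≤ γ)
    (hε : 0 < ε) (hε1 : ε < 1) (hδ : 0 < δ) (hδ1 : δ < 1) (hM : 0 < M)
    (hMB : (M : ℝ) ≤ B * ε ^ (-(1 : ℝ) / γ)) (hK : 0 < numRounds ε) :
    1 ≤ Real.log (1 / (δ / (M : ℝ) ^ (d - 1) / (4 * numRounds ε))) ∧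
    Real.log (1 / (δ / (M : ℝ) ^ (d - 1) / (4 * numRounds ε))) ≤
      8 * (1 + |Real.log B|) * d * ((1 + Real.log (1 / ε)) * (1 + Real.log (1 / δ))) := by
  have hE := log_one_div_pos hε hε1
  have hΔ := log_one_div_pos hδ hδ1
  have hM0 : (0 : ℝ) < M := by exact_mod_cast hM
  have hM1 : (1 : ℝ) ≤ M := by exact_mod_cast hM
  have hK0 : (0 : ℝ) < numRounds ε := by exact_mod_cast hK
  have hK1 : (1 : ℝ) ≤ numRounds ε := by exact_mod_cast hK
  have hd1 : ((d - 1 : ℕ) : ℝ) = (d : ℝ) - 1 := by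
    rw [Nat.cast_sub (by omega), Nat.cast_one]
  have hd2 : (2 : ℝ) ≤ d := by exact_mod_cast hd
  have hγ1 : (1 : ℝ) ≤ γ := by exact_mod_cast hγ
  have heq : Real.log (1 / (δ / (M : ℝ) ^ (d - 1) / (4 * numRounds ε))) =
      Real.log 4 + Real.log (numRounds ε) + (d - 1) * Real.log M + Real.log (1 / δ) := by
    rw [show 1 / (δ / (M : ℝ) ^ (d - 1) / (4 * numRounds ε)) =
      4 * numRounds ε * (M : ℝ) ^ (d - 1) * (1 / δ) by field_simp,
      Real.log_mul (by positivity) (by positivity), Real.log_mul (by positivity) (by positivity),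
      Real.log_mul (by positivity) (by positivity), Real.log_pow, hd1]
  have hlK := Real.log_nonneg hK1
  have hlM := Real.log_nonneg hM1
  have hl4 : Real.log 4 = 2 * Real.log 2 := by
    rw [show (4 : ℝ) = 2 ^ 2 by norm_num, Real.log_pow]; norm_num
  have hlMd : 0 ≤ ((d : ℝ) - 1) * Real.log M := mul_nonneg (by linarith) hlM
  rw [heq]
  -- `log 4` alone exceeds `1`; the other summands are nonnegative.
  refine ⟨by linarith [Real.log_two_gt_d9], ?_⟩
  set E := 1 + Real.log (1 / ε) with hEd
  set D := 1 + Real.log (1 / δ) with hDd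
  set b := 1 + |Real.log B| with hbd
  have hb1 : 1 ≤ b := by linarith [abs_nonneg (Real.log B)]
  have hE1 : 1 ≤ E := by linarith
  have hD1 : 1 ≤ D := by linarith
  have hlogM : Real.log M ≤ b * E := by
    have h1 := Real.log_le_log hM0 hMB
    rw [Real.log_mul hB.ne' (by positivity), Real.log_rpow hε] at h1
    have h2 : -(1 : ℝ) / γ * Real.log ε ≤ Real.log (1 / ε) := by
      rw [one_div, Real.log_inv, neg_div, neg_mul, ← mul_neg]
      rw [one_div ε, Real.log_inv] at hE
      exact mul_le_of_le_one_left hE.le (by rw [div_le_one (by linarith)]; exact hγ1)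
    have h3 := le_abs_self (Real.log B)
    nlinarith
  have hlogK : Real.log (numRounds ε) ≤ 4 * E := by
    linarith [Real.log_le_sub_one_of_pos hK0, numRounds_le hε hε1]
  have hED : 1 ≤ E * D := by nlinarith
  have hdb : 1 ≤ b * d := by nlinarith
  have hbd0 : 0 ≤ b * d := by linarith
  have t1 : E * D ≤ b * d * (E * D) := le_mul_of_one_le_left (by linarith) hdb
  have t2 : E ≤ E * D := le_mul_of_one_le_right (by linarith) hD1
  have t3 : D ≤ E * D := le_mul_of_one_le_left (by linarith) hE1
  have t4 : ((d : ℝ) - 1) * Real.log M ≤ d * (b * E) :=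
    mul_le_mul (by linarith) hlogM hlM (by linarith)
  have t5 : d * (b * E) ≤ b * d * (E * D) := by
    calc d * (b * E) = b * d * E := by ring
      _ ≤ b * d * (E * D) := by gcongr
  calc _ ≤ 2 + 4 * E + d * (b * E) + D := by linarith [Real.log_two_lt_d9]
    _ ≤ 8 * (b * d * (E * D)) := by linarith
    _ = _ := by ring

section

variable {d : ℕ} {g : (Fin (d - 1) → ℝ) → ℝ} {f : ℝ → ℝ} {c : ℝ} {P : Labeler d}

/-- The failure probabilities `4η` of the passes add up to `δ`. Without passes (`ε ≥ 1/2`) nothing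
can fail, so `hΛ` is only asked when there are some. -/
theorem responseLaw_not_runSucceeds_le {D₀ D₁ : ℝ} (hD₀ : IsMeanConstant D₀)
    (hD₁ : IsVarConstant D₁) (hc : 0 < c) (hc1 : c < 1) (hP : MonotoneCondition g P)
    (hS : ShapeCondition g f c P) (hg : Set.MapsTo g (unitCube d) (Set.Icc 0 1)) {M N : ℕ}
    {ε δ : ℝ} (hε : 0 < ε) (hδ : 0 < δ)
    (hΛ : 0 < numRounds ε → 1 ≤ Real.log (1 / (δ / (4 * numRounds ε))))
    (hN : ((52 * D₁ + 8) / c) ^ 4 * Real.log (1 / (δ / (4 * numRounds ε))) ≤ f (ε / 2) * N)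
    (l : GridIndex d M) :
    responseLaw P M {ω | ¬ RunSucceeds D₀ D₁ ε δ l (g (gridPoint l)) N (numRounds ε) ω} ≤
      ENNReal.ofReal δ := by
  have hx := gridPoint_mem_unitCube l
  refine (measure_not_runSucceeds_le P (b := ENNReal.ofReal (4 * (δ / (4 * numRounds ε))))
    (hg hx) fun k hk I hI hθ => ?_).trans ?_
  · have hK : 0 < numRounds ε := by omega
    have hK0 : (0 : ℝ) < numRounds ε := by exact_mod_cast hK
    obtain ⟨h0, h1, h2⟩ := reachable_bounds hI
    have h3 := lt_pow_of_lt_numRounds hε hk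
    have h4 : ((3 : ℝ) / 4) ^ k ≤ 1 := pow_le_one₀ (by norm_num) (by norm_num)
    refine labelerRoundLaw_not_roundSucceeds_le hD₀ hD₁ hc hc1 hP hS hx (hg hx) h0 h1
      (by linarith) hθ rfl (by positivity) (hΛ hK) (hN.trans ?_)
    gcongr
    exact hS.monotone ⟨by linarith, by linarith⟩ ⟨by linarith, by linarith⟩ (by linarith)
  · rw [← ENNReal.ofReal_natCast, ← ENNReal.ofReal_mul (Nat.cast_nonneg _)]
    refine ENNReal.ofReal_le_ofReal ?_
    rcases Nat.eq_zero_or_pos (numRounds ε) with h | h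
    · simp [h, hδ.le]
    · have hK0 : (0 : ℝ) < numRounds ε := by exact_mod_cast h
      field_simp
      exact le_rfl

theorem algorithmTwo_of_runSucceeds {D₀ D₁ ε δ : ℝ} {γ M N : ℕ} {θ : GridIndex d M → ℝ}
    {ω : QueryIndex d M → Response}
    (h : ∀ l, RunSucceeds D₀ D₁ ε (δ / (M : ℝ) ^ (d - 1)) l (θ l) N (numRounds ε) ω) :
    ∃ (ĝ : (Fin (d - 1) → ℝ) → ℝ) (n : ℕ), algorithmTwo D₀ D₁ ε δ γ M ω = some (ĝ, n) ∧
      n ≤ M ^ (d - 1) * (3 * N * numRounds ε) := by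
  choose I m h1 h2 _ using h
  have hrun : ∀ l, gridRun D₀ D₁ ε δ M ω l = some (((I l).1 + (I l).2) / 2, m l) := by
    intro l
    have := h1 l
    rw [runState] at this
    rw [gridRun, algorithmOne, this]
    rfl
  have hsome : ∀ l, (gridRun D₀ D₁ ε δ M ω l).isSome := fun l => by rw [hrun l]; rfl
  refine ⟨_, _, by rw [algorithmTwo, dif_pos hsome], ?_⟩
  have hget : ∀ l, ((gridRun D₀ D₁ ε δ M ω l).get (hsome l)).2 = m l := fun l => by
    simp [hrun l]
  simp_rw [hget]
  refine (Finset.sum_le_card_nsmul _ _ _ fun l _ => h2 l).trans ?_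
  simp

end

end

theorem mainTheorem9 :
    (∃ D₀ : ℝ, IsMeanConstant D₀) ∧ (∃ D₁ : ℝ, IsVarConstant D₁) ∧
    ∃ p : ℕ, ∀ D₀ D₁ : ℝ, IsMeanConstant D₀ → IsVarConstant D₁ →
      ∀ c : ℝ, 0 < c → c < 1 → ∀ B : ℝ, 0 < B →
      ∃ C : ℝ, 0 < C ∧
        ∀ (d γ M : ℕ) (ε δ : ℝ) (g : (Fin (d - 1) → ℝ) → ℝ) (f : ℝ → ℝ) (P : Labeler d),
          2 ≤ d → 1 ≤ γ → 0 < ε → ε < 1 → 0 < δ → δ < 1 →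
          0 < M → γ ∣ M → (M : ℝ) ≤ B * ε ^ (-(1 : ℝ) / γ) →
          Set.MapsTo g (unitCube d) (Set.Icc 0 1) →
          MonotoneCondition g P → ShapeCondition g f c P →
          ENNReal.ofReal (1 - δ) ≤ responseLaw P M
            {ω | ∃ (ĝ : (Fin (d - 1) → ℝ) → ℝ) (n : ℕ),
              algorithmTwo D₀ D₁ ε δ γ M ω = some (ĝ, n) ∧
              (n : ℝ) ≤
                C * ((1 + Real.log (1 / ε)) * (1 + Real.log (1 / δ)) * (1 + Real.log d)) ^ p *
                  (d / f (ε / 2) * (B ^ (d - 1) * ε ^ (-((d : ℝ) - 1) / γ)))} := by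
  refine ⟨exists_isMeanConstant, exists_isVarConstant, 2, fun D₀ D₁ hD₀ hD₁ c hc hc1 B hB => ?_⟩
  set k := (52 * D₁ + 8) / c with hk
  have hD₁0 := hD₁.pos
  have hk1 : 1 ≤ k := by
    rw [hk, le_div_iff₀ hc]
    linarith
  have hb := abs_nonneg (Real.log B)
  refine ⟨192 * k ^ 4 * (1 + |Real.log B|), by positivity, ?_⟩
  intro d γ M ε δ g f P hd hγ hε hε1 hδ hδ1 hM _ hMB hg hP hS
  have hM0 : (0 : ℝ) < M := by exact_mod_cast hM
  have hE := log_one_div_pos hε hε1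
  have hΔ := log_one_div_pos hδ hδ1
  have hd2 : (2 : ℝ) ≤ d := by exact_mod_cast hd
  have hld : 0 ≤ Real.log d := Real.log_nonneg (by linarith)
  have hf0 := hS.pos (ε / 2) (by linarith) (by linarith)
  have hf1 := (hS.mapsTo (x := ε / 2) ⟨by linarith, by linarith⟩).2
  set δ' := δ / (M : ℝ) ^ (d - 1) with hδ'
  have hδ'0 : 0 < δ' := by positivity
  set Λ := Real.log (1 / (δ' / (4 * numRounds ε))) with hΛ
  have hlevel := log_one_div_level_le hB hd hγ hε hε1 hδ hδ1 hM hMB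
  set N := ⌈k ^ 4 * Λ / f (ε / 2)⌉₊ with hN
  have hNle : k ^ 4 * Λ ≤ f (ε / 2) * N := by
    have := Nat.le_ceil (k ^ 4 * Λ / f (ε / 2))
    rwa [div_le_iff₀ hf0, mul_comm (N : ℝ)] at this
  have : IsProbabilityMeasure (responseLaw P M) := by rw [responseLaw]; infer_instance
  refine ofReal_one_sub_le_of_compl hδ.le ?_
  have hsub : {ω | ∃ (ĝ : (Fin (d - 1) → ℝ) → ℝ) (n : ℕ),
      algorithmTwo D₀ D₁ ε δ γ M ω = some (ĝ, n) ∧ (n : ℝ) ≤ 192 * k ^ 4 * (1 + |Real.log B|) *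
        ((1 + Real.log (1 / ε)) * (1 + Real.log (1 / δ)) * (1 + Real.log d)) ^ 2 *
        (d / f (ε / 2) * (B ^ (d - 1) * ε ^ (-((d : ℝ) - 1) / γ)))}ᶜ ⊆
      ⋃ l : GridIndex d M,
        {ω | ¬ RunSucceeds D₀ D₁ ε δ' l (g (gridPoint l)) N (numRounds ε) ω} := by
    intro ω hω
    by_contra hcon
    simp only [Set.mem_iUnion, Set.mem_ofPred_eq, not_exists, not_not] at hcon
    obtain ⟨ĝ, n, h1, h2⟩ := algorithmTwo_of_runSucceeds (γ := γ) hcon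
    refine hω ⟨ĝ, n, h1, ?_⟩
    have h3 : (n : ℝ) ≤ (M : ℝ) ^ (d - 1) * (3 * N * numRounds ε) := by exact_mod_cast h2
    have hMd : (M : ℝ) ^ (d - 1) ≤ B ^ (d - 1) * ε ^ (-((d : ℝ) - 1) / γ) := by
      refine (pow_le_pow_left₀ hM0.le hMB _).trans_eq ?_
      rw [mul_pow, ← Real.rpow_mul_natCast hε.le, Nat.cast_sub (by omega), Nat.cast_one]
      congr 2
      ring
    have hNK : 3 * (N : ℝ) * numRounds ε ≤ 192 * k ^ 4 * (1 + |Real.log B|) *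
        ((1 + Real.log (1 / ε)) * (1 + Real.log (1 / δ)) * (1 + Real.log d)) ^ 2 *
        (d / f (ε / 2)) := by
      -- Without passes no query is made, and the lower bound on `Λ` is unavailable.
      rcases Nat.eq_zero_or_pos (numRounds ε) with hK | hK
      · rw [hK, Nat.cast_zero, mul_zero]
        positivity
      obtain ⟨hΛ1, hΛ2⟩ := hlevel hK
      set E := 1 + Real.log (1 / ε)
      set D := 1 + Real.log (1 / δ)
      set L := 1 + Real.log d
      set b := 1 + |Real.log B|
      have hE1 : 1 ≤ E := by linarith
      have hD1 : 1 ≤ D := by linarith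
      have hL1 : 1 ≤ L := by linarith
      have hx1 : 1 ≤ k ^ 4 * Λ / f (ε / 2) := by
        rw [le_div_iff₀ hf0]
        have : 1 ≤ k ^ 4 * Λ := one_le_mul_of_one_le_of_one_le (one_le_pow₀ hk1) hΛ1
        linarith
      have hN2 : (N : ℝ) ≤ 2 * (k ^ 4 * Λ / f (ε / 2)) := by
        have := Nat.ceil_lt_add_one (by linarith : 0 ≤ k ^ 4 * Λ / f (ε / 2))
        linarith
      -- One factor `E` counts the passes and `E * D` comes from `Λ`; hence the exponent `2`.
      have hED : E * (E * D) ≤ (E * D * L) ^ 2 := by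
        have h4 : E * D ≤ E * D * L := le_mul_of_one_le_right (by positivity) hL1
        have h5 : E ≤ E * D * L :=
          (le_mul_of_one_le_right (by linarith) hD1).trans h4
        rw [sq]
        exact mul_le_mul h5 h4 (by positivity) (by positivity)
      -- `192 = 3 * 2 * 8 * 4`: queries per iteration, rounding up `N`, the bound on `Λ`, the bound
      -- on the number of passes.
      calc 3 * (N : ℝ) * numRounds ε
          ≤ 3 * (2 * (k ^ 4 * (8 * b * d * (E * D)) / f (ε / 2))) * (4 * E) := by
            have h6 : k ^ 4 * Λ / f (ε / 2) ≤ k ^ 4 * (8 * b * d * (E * D)) / f (ε / 2) := by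
              gcongr
            have h7 := numRounds_le hε hε1
            gcongr
            exact hN2.trans (by linarith)
        _ = 192 * k ^ 4 * b * (E * (E * D)) * (d / f (ε / 2)) := by ring
        _ ≤ 192 * k ^ 4 * b * (E * D * L) ^ 2 * (d / f (ε / 2)) := by gcongr
    rw [← mul_assoc]
    calc (n : ℝ) ≤ (M : ℝ) ^ (d - 1) * (3 * N * numRounds ε) := h3
      _ = 3 * N * numRounds ε * (M : ℝ) ^ (d - 1) := by ring
      _ ≤ _ := mul_le_mul hNK hMd (by positivity) (by positivity)
  -- A union bound over the `M ^ (d - 1)` grid lines, each failing with probability at most `δ'`.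
  refine (measure_mono hsub).trans ((measure_iUnion_le _).trans ?_)
  refine (ENNReal.tsum_le_tsum fun l => responseLaw_not_runSucceeds_le hD₀ hD₁ hc hc1 hP hS hg hε
    hδ'0 (fun hK => (hlevel hK).1) hNle l).trans_eq ?_
  rw [tsum_fintype, Finset.sum_const, Finset.card_univ, Fintype.card_fun, Fintype.card_fin,
    Fintype.card_fin, nsmul_eq_mul, ← ENNReal.ofReal_natCast, ← ENNReal.ofReal_mul (by positivity)]
  congr 1
  rw [hδ']
  push_cast
  field_simp
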